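/- There is a universal constant $C>0$ such that the following holds. Let $d,n\ge 1$, let $p\ge 4$ be real, and let $X_1,\dots,X_n$ be i.i.d. copies of a random vector $X$ in $\mathbb{R}^d$ with $\mathbb{E}\|X\|^p<\infty$, $\mathbb{E}X=0$ and covariance matrix $\Sigma\neq 0$. Write $\|\cdot\|$ for the Euclidean norm on vectors and the operator norm on matrices, $r(\Sigma)=\operatorname{tr}(\Sigma)/\|\Sigma\|$, and for $q\in\{4,p\}$ $$\kappa_q=\sup_{v\in\mathbb{R}^d,\ \langle v,\Sigma v\rangle=1}\bigl(\mathbb{E}|\langle X,v\rangle|^q\bigr)^{1/q}.$$ For $B>0$ let $$\varepsilon(B)=\sup_{\|v\|=1}\frac1n\Bigl|\sum_{i=1}^n\bigl(\langle X_i,v\rangle^2\wedge B-\mathbb{E}[\langle X_i,v\rangle^2\wedge B]\bigr)\Bigr| ,$$ and for $t\in\mathbb{N}$, $t\ge 1$, let $$B_p(t)=\|\Sigma\|\left[\left(4\kappa_p^2\Bigl(\frac{2000\,n}{t}\Bigr)^{2/p}\right)\vee\left(512\,\kappa_4^2\,r(\Sigma)\,\frac{\sqrt n}{t^{3/2}}\right)\right].$$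 Let $\alpha\in(0,1)$ and let $t\in\mathbb{N}$ satisfy $t\ge 2$ and $t\ge\log\bigl(8/(3\alpha)\bigr)$. Then, with probability at least $1-\alpha$, $$\varepsilon(B_p(t))\le C\,\kappa_4^2\,\|\Sigma\|\sqrt{\frac{t+2\log(8/\alpha)}{n}}+C\,\kappa_p^2\,\|\Sigma\|\Bigl(\frac tn\Bigr)^{1-2/p}+C\,\kappa_4^2\,\|\Sigma\|\,\frac{r(\Sigma)}{\sqrt{nt}} .$$ -/

import Mathlib

open MeasureTheory ProbabilityTheory

noncomputable section

namespace TruncatedCovariance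

/-- The covariance matrix `Σ` of a random vector `X` of `ℝ^d`. -/
def covMat {Ω : Type*} [MeasurableSpace Ω] {d : ℕ} (X : Ω → EuclideanSpace ℝ (Fin d))
    (μ : Measure Ω) : Matrix (Fin d) (Fin d) ℝ :=
  Matrix.of fun i j => cov[fun ω => X ω i, fun ω => X ω j; μ]

/-- The operator norm of a square matrix acting on Euclidean space. -/
def opNorm {d : ℕ} (M : Matrix (Fin d) (Fin d) ℝ) : ℝ :=
  ‖Matrix.toEuclideanCLM (n := Fin d) (𝕜 := ℝ) M‖

/-- The quadratic form `⟨v, M v⟩`. -/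
def quadForm {d : ℕ} (M : Matrix (Fin d) (Fin d) ℝ) (v : EuclideanSpace ℝ (Fin d)) : ℝ :=
  inner ℝ v (Matrix.toEuclideanCLM (n := Fin d) (𝕜 := ℝ) M v)

/-- The stable (effective) rank `r(M) = tr M / ‖M‖`. -/
def stableRank {d : ℕ} (M : Matrix (Fin d) (Fin d) ℝ) : ℝ :=
  M.trace / opNorm M

/-- The hypercontractivity constant
`κ_p = sup { (E |⟨X, v⟩|^p)^(1/p) : ⟨v, Σ v⟩ = 1 }`.
The supremum is over a nonempty set when `Σ ≠ 0`, and bounded when `E ‖X‖^p < ∞` and `p ≥ 2`. -/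
def kappa {Ω : Type*} [MeasurableSpace Ω] {d : ℕ} (X : Ω → EuclideanSpace ℝ (Fin d))
    (μ : Measure Ω) (p : ℝ) : ℝ :=
  ⨆ v : {v : EuclideanSpace ℝ (Fin d) // quadForm (covMat X μ) v = 1},
    (∫ ω, |inner ℝ (X ω) v.1| ^ p ∂μ) ^ (1 / p)

/-- The truncation level `B_p(t)` for a sample of size `n`. -/
def truncLevel {Ω : Type*} [MeasurableSpace Ω] {d : ℕ} (X : Ω → EuclideanSpace ℝ (Fin d))
    (μ : Measure Ω) (n : ℕ) (p t : ℝ) : ℝ :=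
  opNorm (covMat X μ) *
    max (4 * kappa X μ p ^ 2 * (2000 * (n : ℝ) / t) ^ (2 / p))
      (512 * kappa X μ 4 ^ 2 * stableRank (covMat X μ) * (√(n : ℝ) / t ^ (3 / 2 : ℝ)))

/-- The truncated empirical process, evaluated at `ω`:
`ε(B) = sup_{‖v‖ = 1} (1/n) |∑_i (⟨X_i, v⟩² ∧ B - E[⟨X_i, v⟩² ∧ B])|`. -/
def truncProcess {Ω : Type*} [MeasurableSpace Ω] {d n : ℕ}
    (X : Fin n → Ω → EuclideanSpace ℝ (Fin d)) (μ : Measure Ω) (B : ℝ) (ω : Ω) : ℝ :=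
  ⨆ v : Metric.sphere (0 : EuclideanSpace ℝ (Fin d)) 1,
    (1 / (n : ℝ)) *
      |∑ i, (min (inner ℝ (X i ω) v.1 ^ 2) B - ∫ ω', min (inner ℝ (X i ω') v.1 ^ 2) B ∂μ)|

end TruncatedCovariance

end

/-!
Uniform deviation of truncated squares of linear forms, by Gaussian smoothing (PAC-Bayes).
-/

/-! The supremum over the sphere is handled by PAC-Bayes smoothing: each direction `v` is perturbed
by a Gaussian `g` of covariance `(1/t) • id`. For a fixed direction, Bernstein's estimate bounds a
normalised exponential moment of a sum of bounded variables by 1. Averaging over a Gaussian prior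
centred at 0 and applying Markov gives a single event in the sample; the Gibbs variational
inequality then passes from the prior to its translate by any `v`, at the price `b‖v‖²` with `b =
t/2`. All directions are thus controlled at once (`exists_pacBayes_event`), but for Gaussian
averages of bounded functions rather than for `⟨x, v⟩² ∧ B` itself.

It remains to sandwich `⟨x, v⟩² ∧ B` between such averages. Averaging `⟨x, v + g⟩²` adds exactly `σ²
= ‖x‖²/t`. After truncation, subtracting `σ² ∧ B` leaves a minorant, by Jensen and subadditivity of
`· ∧ B` (`integral_truncLower_le`). For a majorant there are two cases. If `|⟨x, v⟩| ≤ 3√B/4`,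
truncation acts only when `|⟨x, g⟩| > √B/4`, which costs `O(σ⁴/B)` through a fourth moment.
Otherwise the symmetry of `g` makes the added term `jump` worth at least `2B` on average
(`min_le_integral_truncUpper`). The bias of both functions is at most `far B ⟨x, v⟩ + O(σ⁴/B)`.

The two entries of the truncation level make this bias affordable. The first gives `P(⟨X, v⟩² > B/4)
≤ t/(2000n)` by Markov with the `p`-th moment; the second, with `E‖X‖⁴ ≤ κ₄⁴ (tr Σ)²`, makes `E
σ⁴/B` of order `κ₄² tr Σ / √(nt)`. Bernstein contributes `√(tV/n) + Bt/n` with `V` of order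
`κ₄⁴(‖Σ‖² + (tr Σ)²/t²)`, and expanding `Bt/n` yields the remaining terms. -/

namespace TruncatedCovariance

/-! ### Gaussian prior: one-dimensional marginals, translation, Gibbs inequality. -/

section Gaussian

/-- The density of the centred Gaussian measure with covariance `(2b)⁻¹ • id`. -/
noncomputable def gaussDensity (E : Type*) [NormedAddCommGroup E] [InnerProductSpace ℝ E]
    (b : ℝ) (x : E) : ℝ :=
  ((Real.pi / b) ^ (Module.finrank ℝ E / 2 : ℝ))⁻¹ * Real.exp (-b * ‖x‖ ^ 2)

lemma gaussDensity_pos {E : Type*} [NormedAddCommGroup E] [InnerProductSpace ℝ E] {b : ℝ}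
    (hb : 0 < b) (x : E) : 0 < gaussDensity E b x := by
  unfold gaussDensity
  have := Real.pi_pos
  positivity

lemma measurable_gaussDensity {E : Type*} [NormedAddCommGroup E] [InnerProductSpace ℝ E]
    [MeasurableSpace E] [BorelSpace E] (b : ℝ) : Measurable (gaussDensity E b) := by
  unfold gaussDensity
  fun_prop

variable {E : Type*} [NormedAddCommGroup E] [InnerProductSpace ℝ E] [FiniteDimensional ℝ E]
  [MeasurableSpace E] [BorelSpace E]

/-- The centred Gaussian measure with covariance `(2b)⁻¹ • id`. -/
noncomputable def gaussPrior (E : Type*) [NormedAddCommGroup E] [InnerProductSpace ℝ E]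
    [FiniteDimensional ℝ E] [MeasurableSpace E] [BorelSpace E] (b : ℝ) : Measure E :=
  (volume : Measure E).withDensity fun x => ENNReal.ofReal (gaussDensity E b x)

lemma integral_gaussPrior {F : Type*} [NormedAddCommGroup F] [NormedSpace ℝ F]
    {b : ℝ} (hb : 0 < b) (f : E → F) :
    ∫ x, f x ∂(gaussPrior E b) = ∫ x, gaussDensity E b x • f x := by
  unfold gaussPrior
  rw [integral_withDensity_eq_integral_toReal_smul (measurable_gaussDensity b).ennreal_ofReal
    (by simp)]
  simp [ENNReal.toReal_ofReal (gaussDensity_pos hb _).le]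

lemma integrable_gaussPrior_iff {b : ℝ} (hb : 0 < b) (f : E → ℝ) :
    Integrable f (gaussPrior E b) ↔ Integrable fun x => gaussDensity E b x * f x := by
  unfold gaussPrior
  rw [integrable_withDensity_iff_integrable_smul' (measurable_gaussDensity b).ennreal_ofReal
    (by simp)]
  simp [ENNReal.toReal_ofReal (gaussDensity_pos hb _).le]

lemma integral_gaussDensity {b : ℝ} (hb : 0 < b) : ∫ x, gaussDensity E b x = 1 := by
  unfold gaussDensity
  rw [integral_const_mul, GaussianFourier.integral_rexp_neg_mul_sq_norm hb]
  have : 0 < (Real.pi / b) ^ (Module.finrank ℝ E / 2 : ℝ) := by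
    have := Real.pi_pos
    positivity
  field_simp

lemma isProbabilityMeasure_gaussPrior {b : ℝ} (hb : 0 < b) :
    IsProbabilityMeasure (gaussPrior E b) := by
  constructor
  have hint : Integrable (gaussDensity E b) :=
    Integrable.of_integral_ne_zero (by rw [integral_gaussDensity hb]; exact one_ne_zero)
  rw [gaussPrior, withDensity_apply _ MeasurableSet.univ, Measure.restrict_univ,
    ← ofReal_integral_eq_lintegral_ofReal hint
      (Filter.Eventually.of_forall fun x => (gaussDensity_pos hb x).le),
    integral_gaussDensity hb, ENNReal.ofReal_one]

lemma map_inner_gaussPrior {b : ℝ} (hb : 0 < b) (x : E) :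
    (gaussPrior E b).map (fun g => inner ℝ x g) =
      gaussianReal 0 (Real.toNNReal (‖x‖ ^ 2 / (2 * b))) := by
  have := isProbabilityMeasure_gaussPrior (E := E) hb
  have hm : Measurable (fun g : E => inner ℝ x g) := by fun_prop
  have := Measure.isProbabilityMeasure_map (μ := gaussPrior E b) hm.aemeasurable
  refine Measure.ext_of_charFun (funext fun s => ?_)
  rw [charFun_gaussianReal, charFun_apply_real, integral_map hm.aemeasurable (by fun_prop),
    integral_gaussPrior hb]
  have h1 : ∀ g : E, gaussDensity E b g • Complex.exp (s * (inner ℝ x g : ℝ) * Complex.I) =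
      (((Real.pi / b) ^ (Module.finrank ℝ E / 2 : ℝ))⁻¹ : ℝ) *
        Complex.exp (-(b : ℂ) * ‖g‖ ^ 2 + (s * Complex.I) * inner ℝ x g) := by
    intro g
    rw [gaussDensity, Complex.real_smul, Complex.exp_add]
    push_cast
    rw [mul_assoc]
    congr 3
    ring
  simp_rw [h1]
  rw [integral_const_mul, GaussianFourier.integral_cexp_neg_mul_sq_norm_add (by simpa using hb)]
  have hp : 0 < (Real.pi / b) ^ (Module.finrank ℝ E / 2 : ℝ) := by
    have := Real.pi_pos
    positivity
  have h2 : ((Real.pi : ℂ) / b) ^ (Module.finrank ℝ E / 2 : ℂ) =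
      (((Real.pi / b) ^ (Module.finrank ℝ E / 2 : ℝ) : ℝ) : ℂ) := by
    rw [Complex.ofReal_cpow (by have := Real.pi_pos; positivity)]
    push_cast
    rfl
  rw [h2, ← mul_assoc, ← Complex.ofReal_mul, inv_mul_cancel₀ hp.ne', Complex.ofReal_one, one_mul]
  congr 1
  have hb' : (b : ℂ) ≠ 0 := by exact_mod_cast hb.ne'
  have h3 : ((Real.toNNReal (‖x‖ ^ 2 / (2 * b)) : NNReal) : ℂ) = (‖x‖ : ℂ) ^ 2 / (2 * b) := by
    have : ((Real.toNNReal (‖x‖ ^ 2 / (2 * b)) : NNReal) : ℝ) = ‖x‖ ^ 2 / (2 * b) :=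
      Real.coe_toNNReal _ (by positivity)
    calc ((Real.toNNReal (‖x‖ ^ 2 / (2 * b)) : NNReal) : ℂ)
        = (((Real.toNNReal (‖x‖ ^ 2 / (2 * b)) : NNReal) : ℝ) : ℂ) := rfl
      _ = _ := by rw [this]; push_cast; ring
  rw [h3, mul_pow, Complex.I_sq]
  push_cast
  field_simp
  ring

/-- Change of measure: the exponential factor is the ratio of the density at `v + g` to the density
at `g`. Its logarithm is what enters Jensen's inequality in the Gibbs bound. -/
lemma integral_comp_add_left_gaussPrior {b : ℝ} (hb : 0 < b) (f : E → ℝ) (v : E) :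
    ∫ g, f (v + g) * Real.exp (-2 * b * inner ℝ v g - b * ‖v‖ ^ 2) ∂(gaussPrior E b) =
      ∫ g, f g ∂(gaussPrior E b) := by
  rw [integral_gaussPrior hb, integral_gaussPrior hb,
    ← integral_add_left_eq_self (fun g => gaussDensity E b g • f g) v]
  congr 1 with g
  simp only [smul_eq_mul, gaussDensity]
  have : Real.exp (-b * ‖v + g‖ ^ 2) = Real.exp (-b * ‖g‖ ^ 2) *
      Real.exp (-2 * b * inner ℝ v g - b * ‖v‖ ^ 2) := by
    rw [← Real.exp_add, norm_add_sq_real]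
    ring_nf
  rw [this]
  ring

lemma integrable_comp_add_left_gaussPrior {b : ℝ} (hb : 0 < b) {f : E → ℝ} (v : E)
    (hf : Integrable f (gaussPrior E b)) :
    Integrable (fun g => f (v + g) * Real.exp (-2 * b * inner ℝ v g - b * ‖v‖ ^ 2))
      (gaussPrior E b) := by
  rw [integrable_gaussPrior_iff hb] at hf ⊢
  refine (hf.comp_add_left v).congr (Filter.Eventually.of_forall fun g => ?_)
  simp only [gaussDensity]
  have : Real.exp (-b * ‖v + g‖ ^ 2) = Real.exp (-b * ‖g‖ ^ 2) *
      Real.exp (-2 * b * inner ℝ v g - b * ‖v‖ ^ 2) := by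
    rw [← Real.exp_add, norm_add_sq_real]
    ring_nf
  rw [this]
  ring

lemma integral_comp_neg_gaussPrior {b : ℝ} (hb : 0 < b) (f : E → ℝ) :
    ∫ g, f (-g) ∂(gaussPrior E b) = ∫ g, f g ∂(gaussPrior E b) := by
  rw [integral_gaussPrior hb, integral_gaussPrior hb,
    ← integral_neg_eq_self (fun g => gaussDensity E b g • f g)]
  simp [gaussDensity]

lemma integrable_inner_pow_gaussPrior {b : ℝ} (hb : 0 < b) (x : E) (k : ℕ) :
    Integrable (fun g => inner ℝ x g ^ k) (gaussPrior E b) := by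
  have hm : Measurable (fun g : E => inner ℝ x g) := by fun_prop
  have h := (memLp_id_gaussianReal (μ := 0)
    (v := Real.toNNReal (‖x‖ ^ 2 / (2 * b))) k).integrable_norm_pow'
  rw [← map_inner_gaussPrior hb x] at h
  have h2 := (integrable_map_measure (by fun_prop) hm.aemeasurable).1 h
  refine h2.mono' (by fun_prop) (Filter.Eventually.of_forall fun g => ?_)
  simp

lemma integral_inner_gaussPrior {b : ℝ} (hb : 0 < b) (x : E) :
    ∫ g, inner ℝ x g ∂(gaussPrior E b) = 0 := by
  have hm : Measurable (fun g : E => inner ℝ x g) := by fun_prop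
  have h := integral_map (μ := gaussPrior E b) hm.aemeasurable (f := fun y : ℝ => y) (by fun_prop)
  rw [← h, map_inner_gaussPrior hb x, integral_id_gaussianReal]

lemma integral_inner_sq_gaussPrior {b : ℝ} (hb : 0 < b) (x : E) :
    ∫ g, inner ℝ x g ^ 2 ∂(gaussPrior E b) = ‖x‖ ^ 2 / (2 * b) := by
  have hm : Measurable (fun g : E => inner ℝ x g) := by fun_prop
  have h := integral_map (μ := gaussPrior E b) hm.aemeasurable (f := fun y : ℝ => y ^ 2)
    (by fun_prop)
  rw [← h, map_inner_gaussPrior hb x]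
  have h2 := variance_fun_id_gaussianReal (μ := 0) (v := Real.toNNReal (‖x‖ ^ 2 / (2 * b)))
  rw [variance_eq_integral (by fun_prop)] at h2
  simp only [integral_id_gaussianReal, sub_zero] at h2
  rw [h2, Real.coe_toNNReal _ (by positivity)]

/-- The exact value is 3; a crude bound from `y⁴ ≤ 4! e^|y|` and the moment generating function at
`±1` suffices. -/
lemma integral_pow_four_gaussianReal_le : ∫ y, y ^ 4 ∂(gaussianReal 0 1) ≤ 96 := by
  have hle : ∀ y : ℝ, y ^ 4 ≤ 24 * (Real.exp (1 * y) + Real.exp (-1 * y)) := by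
    intro y
    have h1 := Real.pow_div_factorial_le_exp |y| (abs_nonneg y) 4
    have h2 : Real.exp |y| ≤ Real.exp (1 * y) + Real.exp (-1 * y) := by
      rcases abs_cases y with h | h
      · rw [h.1]; simp; positivity
      · rw [h.1]; simp; positivity
    have h3 : |y| ^ 4 = y ^ 4 := by rw [show 4 = 2 * 2 by norm_num, pow_mul, sq_abs, pow_mul]
    rw [h3] at h1
    norm_num [Nat.factorial] at h1
    simp only [neg_mul, one_mul] at *
    linarith
  have hi : ∀ s : ℝ, Integrable (fun y => Real.exp (s * y)) (gaussianReal 0 1) :=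
    fun s => integrable_exp_mul_gaussianReal s
  have hmgf : ∀ s : ℝ, ∫ y, Real.exp (s * y) ∂(gaussianReal 0 1) = Real.exp (s ^ 2 / 2) := by
    intro s
    have := congrFun (mgf_fun_id_gaussianReal (μ := 0) (v := 1)) s
    simpa [mgf] using this
  calc ∫ y, y ^ 4 ∂(gaussianReal 0 1)
      ≤ ∫ y, 24 * (Real.exp (1 * y) + Real.exp (-1 * y)) ∂(gaussianReal 0 1) := by
        refine integral_mono_of_nonneg (Filter.Eventually.of_forall fun y => ?_)
          (((hi 1).add (hi (-1))).const_mul 24) (Filter.Eventually.of_forall hle)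
        simp only [Pi.zero_apply]
        positivity
    _ = 48 * Real.exp (1 / 2) := by
        rw [integral_const_mul, integral_add (hi 1) (hi (-1)), hmgf, hmgf]
        norm_num
        ring
    _ ≤ 96 := by
        have h1 : Real.exp (1 / 2) ≤ 2 := by
          have h := Real.exp_one_lt_d9
          have h2 : Real.exp (1 / 2) ^ 2 = Real.exp 1 := by
            rw [← Real.exp_nat_mul]; norm_num
          nlinarith [Real.exp_pos (1 / 2)]
        linarith

lemma integral_inner_pow_four_gaussPrior_le {b : ℝ} (hb : 0 < b) (x : E) :
    ∫ g, inner ℝ x g ^ 4 ∂(gaussPrior E b) ≤ 96 * (‖x‖ ^ 2 / (2 * b)) ^ 2 := by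
  have hm : Measurable (fun g : E => inner ℝ x g) := by fun_prop
  have h := integral_map (μ := gaussPrior E b) hm.aemeasurable (f := fun y : ℝ => y ^ 4)
    (by fun_prop)
  set s : ℝ := ‖x‖ ^ 2 / (2 * b) with hs
  have hs0 : 0 ≤ s := by positivity
  have h2 := gaussianReal_map_const_mul (μ := 0) (v := 1) (√s)
  have h3 : (⟨√s ^ 2, sq_nonneg _⟩ : NNReal) * 1 = Real.toNNReal s := by
    apply NNReal.eq
    rw [mul_one, Real.coe_toNNReal _ hs0]
    exact Real.sq_sqrt hs0
  have h4 : (gaussianReal 0 1).map (√s * ·) = gaussianReal 0 (Real.toNNReal s) := by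
    rw [← h3, h2, mul_zero]
    rfl
  rw [← h, map_inner_gaussPrior hb x, ← hs, ← h4, integral_map (by fun_prop) (by fun_prop)]
  simp_rw [mul_pow]
  rw [integral_const_mul, show √s ^ 4 = s ^ 2 by
    rw [show 4 = 2 * 2 by norm_num, pow_mul, Real.sq_sqrt hs0]]
  nlinarith [integral_pow_four_gaussianReal_le, sq_nonneg s]

/-- The Gibbs variational inequality for a translate of the Gaussian prior. -/
lemma integral_comp_add_left_le_of_integral_exp_le {b : ℝ} (hb : 0 < b) {Z : E → ℝ}
    (hZ : Measurable Z) {M : ℝ} (hM : ∀ x, |Z x| ≤ M) {a : ℝ}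
    (h : ∫ x, Real.exp (Z x) ∂(gaussPrior E b) ≤ Real.exp a) (v : E) :
    ∫ g, Z (v + g) ∂(gaussPrior E b) ≤ b * ‖v‖ ^ 2 + a := by
  have := isProbabilityMeasure_gaussPrior (E := E) hb
  have hi1 : Integrable (fun x => Real.exp (Z x)) (gaussPrior E b) := by
    refine Integrable.of_bound (by fun_prop) (Real.exp M) (Filter.Eventually.of_forall fun x => ?_)
    rw [Real.norm_eq_abs, Real.abs_exp]
    exact Real.exp_le_exp.2 ((le_abs_self _).trans (hM x))
  have hi2 : Integrable (fun g => Z (v + g)) (gaussPrior E b) :=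
    Integrable.of_bound (hZ.comp (measurable_const_add v)).aestronglyMeasurable M
      (Filter.Eventually.of_forall fun x => hM _)
  have hi3 : Integrable (fun g => inner ℝ v g) (gaussPrior E b) := by
    simpa using integrable_inner_pow_gaussPrior hb v 1
  have heq : ∀ g, Real.exp (Z (v + g)) * Real.exp (-2 * b * inner ℝ v g - b * ‖v‖ ^ 2) =
      Real.exp (Z (v + g) + (-2 * b * inner ℝ v g - b * ‖v‖ ^ 2)) :=
    fun g => (Real.exp_add _ _).symm
  have hi4 := integrable_comp_add_left_gaussPrior hb v hi1
  have h4 := integral_comp_add_left_gaussPrior hb (fun x => Real.exp (Z x)) v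
  simp only [heq] at hi4 h4
  have hi5 : Integrable (fun g => Z (v + g) + (-2 * b * inner ℝ v g - b * ‖v‖ ^ 2))
      (gaussPrior E b) :=
    hi2.add ((hi3.const_mul _).sub (integrable_const _))
  -- Jensen applied to `Z(v + g)` plus the log density ratio: the exponential of the mean is at most
  -- `∫ exp Z`. The linear part of the log ratio has mean zero, so only `b‖v‖²`, the relative
  -- entropy of the translate, remains.
  have hJ := convexOn_exp.map_integral_le (μ := gaussPrior E b)
    Real.continuous_exp.continuousOn isClosed_univ (by simp) hi5 hi4
  rw [h4] at hJ
  have h5 := Real.exp_le_exp.1 (hJ.trans h)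
  have hi6 : Integrable (fun g => -2 * b * inner ℝ v g - b * ‖v‖ ^ 2) (gaussPrior E b) :=
    (hi3.const_mul _).sub (integrable_const _)
  rw [integral_add hi2 hi6,
    integral_sub (hi3.const_mul _) (integrable_const _), integral_const_mul,
    integral_inner_gaussPrior hb] at h5
  simp at h5
  linarith

end Gaussian

/-! ### Bernstein's estimate and the PAC-Bayes event. -/

section PACBayes

variable {E : Type*} [NormedAddCommGroup E] [InnerProductSpace ℝ E] [FiniteDimensional ℝ E]
  [MeasurableSpace E] [BorelSpace E]

lemma exp_le_one_add_add_sq {x : ℝ} (hx : |x| ≤ 1) : Real.exp x ≤ 1 + x + x ^ 2 := by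
  have := Real.abs_exp_sub_one_sub_id_le hx
  linarith [(abs_le.1 this).2]

/-- Bernstein's bound for the centred moment generating function of a bounded variable. -/
lemma integral_exp_bernstein_le_one {𝒳 : Type*} [MeasurableSpace 𝒳] (ν : Measure 𝒳)
    [IsProbabilityMeasure ν] {f : 𝒳 → ℝ} (hf : Measurable f) {M : ℝ} (hM : ∀ x, |f x| ≤ M)
    {lam : ℝ} (hlam : 0 < lam) (hlM : lam * M ≤ 1) :
    ∫ x, Real.exp (lam * f x - (lam * ∫ y, f y ∂ν + lam ^ 2 * ∫ y, f y ^ 2 ∂ν)) ∂ν ≤ 1 := by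
  have hi1 : Integrable f ν :=
    Integrable.of_bound hf.aestronglyMeasurable M (Filter.Eventually.of_forall hM)
  have hi2 : Integrable (fun x => f x ^ 2) ν := by
    refine Integrable.of_bound (by fun_prop) (M ^ 2) (Filter.Eventually.of_forall fun x => ?_)
    rw [Real.norm_eq_abs, abs_pow]
    exact pow_le_pow_left₀ (abs_nonneg _) (hM x) 2
  simp_rw [Real.exp_sub]
  rw [integral_div, div_le_one (Real.exp_pos _)]
  have hle : ∀ x, Real.exp (lam * f x) ≤ 1 + lam * f x + lam ^ 2 * f x ^ 2 := by
    intro x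
    rw [← mul_pow]
    apply exp_le_one_add_add_sq
    rw [abs_mul, abs_of_pos hlam]
    exact (mul_le_mul_of_nonneg_left (hM x) hlam.le).trans hlM
  have hi3 : Integrable (fun x => 1 + lam * f x) ν := (integrable_const 1).add (hi1.const_mul _)
  calc ∫ x, Real.exp (lam * f x) ∂ν
      ≤ ∫ x, 1 + lam * f x + lam ^ 2 * f x ^ 2 ∂ν :=
        integral_mono_of_nonneg (Filter.Eventually.of_forall fun x => (Real.exp_pos _).le)
          (hi3.add (hi2.const_mul _))
          (Filter.Eventually.of_forall hle)
    _ = 1 + (lam * ∫ y, f y ∂ν + lam ^ 2 * ∫ y, f y ^ 2 ∂ν) := by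
        rw [integral_add hi3 (hi2.const_mul _), integral_add (integrable_const 1) (hi1.const_mul _),
          integral_const_mul, integral_const_mul]
        simp [add_assoc]
    _ ≤ _ := by
        rw [add_comm]
        exact Real.add_one_le_exp _

/-- A uniform Bernstein inequality over all translates of a Gaussian prior (PAC-Bayes). -/
theorem exists_pacBayes_event {𝒳 : Type*} [MeasurableSpace 𝒳] (ν : Measure 𝒳)
    [IsProbabilityMeasure ν] {b : ℝ} (hb : 0 < b) {H : 𝒳 → E → ℝ}
    (hH : Measurable (Function.uncurry H)) {M : ℝ} (hM : ∀ x θ, |H x θ| ≤ M) {lam : ℝ}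
    (hlam : 0 < lam) (hlM : lam * M ≤ 1) (n : ℕ) {δ : ℝ} (hδ : 0 < δ) :
    ∃ G : Set (Fin n → 𝒳), MeasurableSet G ∧
      Measure.pi (fun _ : Fin n => ν) Gᶜ ≤ ENNReal.ofReal δ ∧
      ∀ xs ∈ G, ∀ v : E, ∑ i, ∫ g, H (xs i) (v + g) ∂(gaussPrior E b) ≤
        n * ∫ x, ∫ g, H x (v + g) ∂(gaussPrior E b) ∂ν
        + lam * n * ∫ x, ∫ g, H x (v + g) ^ 2 ∂(gaussPrior E b) ∂ν
        + (b * ‖v‖ ^ 2 + Real.log (1 / δ)) / lam := by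
  have := isProbabilityMeasure_gaussPrior (E := E) hb
  set P : Measure E := gaussPrior E b with hP
  set Q : Measure (Fin n → 𝒳) := Measure.pi (fun _ : Fin n => ν) with hQ
  set m : E → ℝ := fun θ => ∫ x, H x θ ∂ν with hm
  set s : E → ℝ := fun θ => ∫ x, H x θ ^ 2 ∂ν with hs
  have hHs : Measurable (Function.uncurry fun θ x => H x θ) := hH.comp measurable_swap
  have hmm : Measurable m := (hHs.stronglyMeasurable.integral_prod_right (ν := ν)).measurable
  have hHs2 : Measurable (Function.uncurry fun θ x => H x θ ^ 2) := hHs.pow_const 2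
  have hsm : Measurable s := (hHs2.stronglyMeasurable.integral_prod_right (ν := ν)).measurable
  have hH2 : ∀ x θ, |H x θ ^ 2| ≤ M ^ 2 := fun x θ => by
    rw [abs_pow]; exact pow_le_pow_left₀ (abs_nonneg _) (hM x θ) 2
  have hmb : ∀ θ, |m θ| ≤ M := fun θ => by
    have := norm_integral_le_of_norm_le_const (μ := ν) (f := fun x => H x θ) (C := M)
      (Filter.Eventually.of_forall fun x => hM x θ)
    simpa using this
  have hsb : ∀ θ, |s θ| ≤ M ^ 2 := fun θ => by
    have := norm_integral_le_of_norm_le_const (μ := ν) (f := fun x => H x θ ^ 2) (C := M ^ 2)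
      (Filter.Eventually.of_forall fun x => hH2 x θ)
    simpa using this
  set Z : (Fin n → 𝒳) → E → ℝ := fun xs θ =>
    ∑ i, (lam * H (xs i) θ - (lam * m θ + lam ^ 2 * s θ)) with hZ
  have hZm : Measurable (Function.uncurry Z) := by
    refine Finset.measurable_sum _ fun i _ => ?_
    have h0 : Measurable fun p : (Fin n → 𝒳) × E => (p.1 i, p.2) :=
      ((measurable_pi_apply i).comp measurable_fst).prodMk measurable_snd
    have h1 : Measurable fun p : (Fin n → 𝒳) × E => H (p.1 i) p.2 := hH.comp h0
    exact (h1.const_mul _).sub (((hmm.comp measurable_snd).const_mul _).add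
      ((hsm.comp measurable_snd).const_mul _))
  set M' : ℝ := n * (lam * M + (lam * M + lam ^ 2 * M ^ 2)) with hM'
  have hZb : ∀ xs θ, |Z xs θ| ≤ M' := by
    intro xs θ
    calc |Z xs θ| ≤ ∑ i : Fin n, |lam * H (xs i) θ - (lam * m θ + lam ^ 2 * s θ)| :=
          Finset.abs_sum_le_sum_abs _ _
      _ ≤ ∑ i : Fin n, (lam * M + (lam * M + lam ^ 2 * M ^ 2)) := by
          refine Finset.sum_le_sum fun i _ => ?_
          have h1 : |lam * H (xs i) θ| ≤ lam * M := by
            rw [abs_mul, abs_of_pos hlam]; exact mul_le_mul_of_nonneg_left (hM _ _) hlam.le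
          have h2 : |lam * m θ| ≤ lam * M := by
            rw [abs_mul, abs_of_pos hlam]; exact mul_le_mul_of_nonneg_left (hmb _) hlam.le
          have h3 : |lam ^ 2 * s θ| ≤ lam ^ 2 * M ^ 2 := by
            rw [abs_mul, abs_of_pos (by positivity : 0 < lam ^ 2)]
            exact mul_le_mul_of_nonneg_left (hsb _) (by positivity)
          exact (abs_sub _ _).trans (add_le_add h1 ((abs_add_le _ _).trans (add_le_add h2 h3)))
      _ = M' := by simp [hM']; ring
  have heb : ∀ xs θ, ‖Real.exp (Z xs θ)‖ ≤ Real.exp M' := fun xs θ => by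
    rw [Real.norm_eq_abs, Real.abs_exp]
    exact Real.exp_le_exp.2 ((le_abs_self _).trans (hZb xs θ))
  have hem : Measurable (Function.uncurry fun xs θ => Real.exp (Z xs θ)) := hZm.exp
  -- `W` is the exponential moment averaged over the prior. It involves no `v`, which is why one
  -- event serves every translate.
  set W : (Fin n → 𝒳) → ℝ := fun xs => ∫ θ, Real.exp (Z xs θ) ∂P with hW
  have hWm : Measurable W := (hem.stronglyMeasurable.integral_prod_right (ν := P)).measurable
  have hW0 : ∀ xs, 0 ≤ W xs := fun xs => integral_nonneg fun θ => (Real.exp_pos _).le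
  have hWi : Integrable W Q := by
    refine Integrable.of_bound hWm.aestronglyMeasurable (Real.exp M')
      (Filter.Eventually.of_forall fun xs => ?_)
    have := norm_integral_le_of_norm_le_const (μ := P) (f := fun θ => Real.exp (Z xs θ))
      (C := Real.exp M') (Filter.Eventually.of_forall fun θ => heb xs θ)
    simpa using this
  have hW1 : ∫ xs, W xs ∂Q ≤ 1 := by
    rw [integral_integral_swap
      (Integrable.of_bound hem.aestronglyMeasurable (Real.exp M')
        (Filter.Eventually.of_forall fun p => heb p.1 p.2))]
    have h1 : ∀ θ, ∫ xs, Real.exp (Z xs θ) ∂Q ≤ 1 := by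
      intro θ
      simp_rw [hZ, Real.exp_sum]
      -- For fixed `θ` the coordinates are independent, so the moment is the `n`-th power of a
      -- one-sample Bernstein factor, itself at most 1.
      rw [hQ, integral_fintype_prod_eq_pow
        (f := fun x => Real.exp (lam * H x θ - (lam * m θ + lam ^ 2 * s θ)))]
      refine pow_le_one₀ (integral_nonneg fun θ => (Real.exp_pos _).le) ?_
      exact integral_exp_bernstein_le_one ν (hH.comp (measurable_id.prodMk measurable_const))
        (fun x => hM x θ) hlam hlM
    calc ∫ θ, ∫ xs, Real.exp (Z xs θ) ∂Q ∂P ≤ ∫ _, (1 : ℝ) ∂P :=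
          integral_mono_of_nonneg (Filter.Eventually.of_forall fun θ =>
            integral_nonneg fun xs => (Real.exp_pos _).le) (integrable_const _)
            (Filter.Eventually.of_forall h1)
      _ = 1 := by simp
  refine ⟨{xs | W xs ≤ 1 / δ}, measurableSet_le hWm measurable_const, ?_, ?_⟩
  · have h1 := mul_meas_ge_le_integral_of_nonneg (Filter.Eventually.of_forall hW0) hWi (1 / δ)
    have h2 : Q.real {xs | 1 / δ ≤ W xs} ≤ δ := by
      have h3 := h1.trans hW1
      rwa [one_div_mul_eq_div, div_le_one hδ] at h3
    calc Q {xs | W xs ≤ 1 / δ}ᶜ ≤ Q {xs | 1 / δ ≤ W xs} :=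
          measure_mono fun xs (hxs : ¬ W xs ≤ 1 / δ) => (not_le.1 hxs).le
      _ ≤ ENNReal.ofReal δ := by
          rw [← ofReal_measureReal]
          exact ENNReal.ofReal_le_ofReal h2
  · intro xs hxs v
    have hxs' : ∫ θ, Real.exp (Z xs θ) ∂P ≤ Real.exp (Real.log (1 / δ)) := by
      rw [Real.exp_log (by positivity)]; exact hxs
    have key := integral_comp_add_left_le_of_integral_exp_le hb
      (hZm.comp (measurable_const.prodMk measurable_id)) (hZb xs) hxs' v
    have hvm : Measurable fun g : E => v + g := measurable_const_add v
    have hiH : ∀ x, Integrable (fun g => H x (v + g)) P := fun x =>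
      Integrable.of_bound (hH.comp (measurable_const.prodMk hvm)).aestronglyMeasurable M
        (Filter.Eventually.of_forall fun g => hM _ _)
    have him : Integrable (fun g => m (v + g)) P :=
      Integrable.of_bound (hmm.comp hvm).aestronglyMeasurable M
        (Filter.Eventually.of_forall fun g => hmb _)
    have his : Integrable (fun g => s (v + g)) P :=
      Integrable.of_bound (hsm.comp hvm).aestronglyMeasurable (M ^ 2)
        (Filter.Eventually.of_forall fun g => hsb _)
    have hshift : Measurable fun p : E × 𝒳 => (p.2, v + p.1) :=
      measurable_snd.prodMk (hvm.comp measurable_fst)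
    have hm' : ∫ g, m (v + g) ∂P = ∫ x, ∫ g, H x (v + g) ∂P ∂ν :=
      integral_integral_swap (f := fun g x => H x (v + g))
        (Integrable.of_bound (hH.comp hshift).aestronglyMeasurable M
          (Filter.Eventually.of_forall fun p => hM _ _))
    have hs' : ∫ g, s (v + g) ∂P = ∫ x, ∫ g, H x (v + g) ^ 2 ∂P ∂ν :=
      integral_integral_swap (f := fun g x => H x (v + g) ^ 2)
        (Integrable.of_bound ((hH.comp hshift).pow_const 2).aestronglyMeasurable (M ^ 2)
          (Filter.Eventually.of_forall fun p => hH2 _ _))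
    have hms : Integrable (fun g => lam * m (v + g) + lam ^ 2 * s (v + g)) P :=
      (him.const_mul _).add (his.const_mul _)
    have hexp : ∫ g, Z xs (v + g) ∂P = lam * ∑ i, ∫ g, H (xs i) (v + g) ∂P
        - n * (lam * ∫ x, ∫ g, H x (v + g) ∂P ∂ν
          + lam ^ 2 * ∫ x, ∫ g, H x (v + g) ^ 2 ∂P ∂ν) := by
      simp only [hZ]
      have hterm : ∀ i ∈ Finset.univ, Integrable
          (fun g => lam * H (xs i) (v + g) - (lam * m (v + g) + lam ^ 2 * s (v + g))) P :=
        fun i _ => ((hiH _).const_mul _).sub hms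
      rw [integral_finsetSum _ hterm]
      have : ∀ i, ∫ g, (lam * H (xs i) (v + g) - (lam * m (v + g) + lam ^ 2 * s (v + g))) ∂P =
          lam * ∫ g, H (xs i) (v + g) ∂P - (lam * ∫ x, ∫ g, H x (v + g) ∂P ∂ν
          + lam ^ 2 * ∫ x, ∫ g, H x (v + g) ^ 2 ∂P ∂ν) := by
        intro i
        rw [integral_sub ((hiH _).const_mul _) hms,
          integral_add (him.const_mul _) (his.const_mul _), integral_const_mul, integral_const_mul,
          integral_const_mul, hm', hs']
      simp_rw [this]
      rw [Finset.sum_sub_distrib, ← Finset.mul_sum, Finset.sum_const, Finset.card_univ,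
        Fintype.card_fin, nsmul_eq_mul]
    change ∫ g, Z xs (v + g) ∂P ≤ _ at key
    rw [hexp] at key
    have h5 : lam * ∑ i, ∫ g, H (xs i) (v + g) ∂P ≤ lam * (n * ∫ x, ∫ g, H x (v + g) ∂P ∂ν
        + lam * n * ∫ x, ∫ g, H x (v + g) ^ 2 ∂P ∂ν
        + (b * ‖v‖ ^ 2 + Real.log (1 / δ)) / lam) := by
      rw [mul_add, mul_div_cancel₀ _ hlam.ne']
      linarith
    exact le_of_mul_le_mul_left h5 hlam

end PACBayes

/-! ### Scalar inequalities for the truncated square under a centred perturbation. -/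

section Truncation

/-- The weight `4B` put on the values `y` with `y² > 9B/16`. -/
noncomputable def jump (B y : ℝ) : ℝ := if 9 * B < 16 * y ^ 2 then 4 * B else 0

/-- The weight `4B` put on the values `y` with `y² > B/4`. -/
noncomputable def far (B y : ℝ) : ℝ := if B < 4 * y ^ 2 then 4 * B else 0

lemma measurable_jump (B : ℝ) : Measurable (jump B) :=
  Measurable.ite (measurableSet_lt (by fun_prop) (by fun_prop)) measurable_const measurable_const

lemma measurable_far (B : ℝ) : Measurable (far B) :=
  Measurable.ite (measurableSet_lt (by fun_prop) (by fun_prop)) measurable_const measurable_const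

lemma jump_nonneg {B : ℝ} (hB : 0 ≤ B) (y : ℝ) : 0 ≤ jump B y := by
  unfold jump; split_ifs <;> linarith

lemma jump_le {B : ℝ} (hB : 0 ≤ B) (y : ℝ) : jump B y ≤ 4 * B := by
  unfold jump; split_ifs <;> linarith

lemma far_nonneg {B : ℝ} (hB : 0 ≤ B) (y : ℝ) : 0 ≤ far B y := by
  unfold far; split_ifs <;> linarith

lemma far_le {B : ℝ} (hB : 0 ≤ B) (y : ℝ) : far B y ≤ 4 * B := by
  unfold far; split_ifs <;> linarith

lemma jump_le_sq {B : ℝ} (y : ℝ) : jump B y ≤ 8 * y ^ 2 := by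
  unfold jump; split_ifs <;> nlinarith [sq_nonneg y]

lemma add_pow_four_le (a z : ℝ) : (a + z) ^ 4 ≤ 8 * a ^ 4 + 8 * z ^ 4 := by
  nlinarith [sq_nonneg (a - z), sq_nonneg (a ^ 2 - z ^ 2), sq_nonneg (a + z),
    sq_nonneg (a * z), mul_nonneg (sq_nonneg (a - z)) (sq_nonneg (a + z)),
    mul_nonneg (sq_nonneg (a - z)) (sq_nonneg (a - z))]

/-- One of `a + z`, `a - z` is at least as large as `a` in absolute value, according to the sign of
`a * z`. -/
lemma jump_le_jump_add_jump {B : ℝ} (hB : 0 ≤ B) (a z : ℝ) :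
    jump B a ≤ jump B (a + z) + jump B (a + -z) := by
  have h1 := jump_nonneg hB (a + z)
  have h2 := jump_nonneg hB (a + -z)
  by_cases h : 9 * B < 16 * a ^ 2
  · rcases le_total 0 (a * z) with h0 | h0
    · have : 9 * B < 16 * (a + z) ^ 2 := by nlinarith [sq_nonneg z]
      simp only [jump, if_pos h, if_pos this] at *
      linarith
    · have : 9 * B < 16 * (a + -z) ^ 2 := by nlinarith [sq_nonneg z]
      simp only [jump, if_pos h, if_pos this] at *
      linarith
  · rw [jump, if_neg h]
    linarith

/-- Starting from `|a| ≤ 3r/4`, exceeding `r` forces `|z| ≥ r/4`; then `|a| ≤ 3|z|`, so both `r` and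
`|a + z|` are at most `4|z|`. -/
lemma sq_add_le_of_lt {r a z : ℝ} (hr : 0 ≤ r) (ha : 4 * |a| ≤ 3 * r) (h : r < |a + z|) :
    (a + z) ^ 2 * r ^ 2 ≤ 256 * z ^ 4 := by
  have h1 := abs_add_le a z
  have hz : r ≤ 4 * |z| := by linarith
  have h2 : |a + z| ≤ 4 * |z| := by linarith
  calc (a + z) ^ 2 * r ^ 2 = |a + z| ^ 2 * r ^ 2 := by rw [sq_abs]
    _ ≤ (4 * |z|) ^ 2 * (4 * |z|) ^ 2 := by gcongr
    _ = 256 * (|z| ^ 2) ^ 2 := by ring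
    _ = 256 * z ^ 4 := by rw [sq_abs]; ring

lemma four_mul_abs_le {B a : ℝ} (hB : 0 ≤ B) (ha : 16 * a ^ 2 ≤ 9 * B) : 4 * |a| ≤ 3 * √B := by
  refine abs_le_of_sq_le_sq' (a := 4 * |a|) ?_ (by positivity) |>.2
  rw [mul_pow, mul_pow, sq_abs, Real.sq_sqrt hB]
  linarith

lemma sq_add_le_min_add {B a : ℝ} (hB : 0 < B) (ha : 16 * a ^ 2 ≤ 9 * B) (z : ℝ) :
    (a + z) ^ 2 ≤ min ((a + z) ^ 2) B + 256 / B * z ^ 4 := by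
  rcases le_or_gt ((a + z) ^ 2) B with h | h
  · rw [min_eq_left h]
    have : 0 ≤ 256 / B * z ^ 4 := by positivity
    linarith
  · have h2 := sq_add_le_of_lt (Real.sqrt_nonneg B) (four_mul_abs_le hB.le ha)
      ((Real.sqrt_lt_sqrt hB.le h).trans_eq (Real.sqrt_sq_eq_abs _))
    rw [Real.sq_sqrt hB.le] at h2
    rw [min_eq_right h.le]
    have h3 : (a + z) ^ 2 ≤ 256 / B * z ^ 4 := by
      rw [div_mul_eq_mul_div, le_div_iff₀ hB]
      exact h2
    linarith

/-- Passing from `|a| ≤ √B/2` to `|a + z| > 3√B/4` needs `|z| ≥ √B/4`, hence `z⁴ ≥ B²/256`, and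
`1024 = 4 · 256`. The gap between the two thresholds is what makes this work. -/
lemma jump_add_le_far_add {B : ℝ} (hB : 0 < B) (a z : ℝ) :
    jump B (a + z) ≤ far B a + 1024 / B * z ^ 4 := by
  have h0 : 0 ≤ 1024 / B * z ^ 4 := by positivity
  by_cases h1 : B < 4 * a ^ 2
  · rw [far, if_pos h1]
    linarith [jump_le hB.le (a + z)]
  · rw [far, if_neg h1]
    by_cases h2 : 9 * B < 16 * (a + z) ^ 2
    · rw [jump, if_pos h2, zero_add, div_mul_eq_mul_div, le_div_iff₀ hB]
      have h3 : 2 * |a| ≤ √B := by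
        refine abs_le_of_sq_le_sq' (a := 2 * |a|) ?_ (by positivity) |>.2
        rw [mul_pow, sq_abs, Real.sq_sqrt hB.le]
        linarith
      have h4 : 3 * √B < 4 * |a + z| := by
        refine lt_of_pow_lt_pow_left₀ 2 (by positivity) ?_
        rw [mul_pow, mul_pow, sq_abs, Real.sq_sqrt hB.le]
        linarith
      have h5 : √B ≤ 4 * |z| := by linarith [abs_add_le a z]
      have h6 : B ≤ 16 * z ^ 2 := by
        calc B = √B ^ 2 := (Real.sq_sqrt hB.le).symm
          _ ≤ (4 * |z|) ^ 2 := by gcongr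
          _ = 16 * z ^ 2 := by rw [mul_pow, sq_abs]; norm_num
      nlinarith
    · rw [jump, if_neg h2]
      linarith

variable {𝒢 : Type*} [MeasurableSpace 𝒢] {P : Measure 𝒢} [IsProbabilityMeasure P] {z : 𝒢 → ℝ}

lemma integrable_add_sq (h1 : Integrable z P) (h2 : Integrable (fun g => z g ^ 2) P) (a : ℝ) :
    Integrable (fun g => (a + z g) ^ 2) P := by
  have : (fun g => (a + z g) ^ 2) = fun g => (a ^ 2 + 2 * a * z g) + z g ^ 2 := by
    ext g; ring
  rw [this]
  exact ((integrable_const _).add (h1.const_mul _)).add h2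

lemma integral_add_sq (h1 : Integrable z P) (h0 : ∫ g, z g ∂P = 0)
    (h2 : Integrable (fun g => z g ^ 2) P) (a : ℝ) :
    ∫ g, (a + z g) ^ 2 ∂P = a ^ 2 + ∫ g, z g ^ 2 ∂P := by
  have : (fun g => (a + z g) ^ 2) = fun g => (a ^ 2 + 2 * a * z g) + z g ^ 2 := by
    ext g; ring
  have h3 : Integrable (fun g => a ^ 2 + 2 * a * z g) P :=
    (integrable_const _).add (h1.const_mul _)
  rw [this, integral_add h3 h2, integral_add (integrable_const _) (h1.const_mul _),
    integral_const_mul, h0]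
  simp

lemma integrable_min_add_sq (hz : Measurable z) {B : ℝ} (hB : 0 ≤ B) (a : ℝ) :
    Integrable (fun g => min ((a + z g) ^ 2) B) P := by
  refine Integrable.of_bound (by fun_prop) B (Filter.Eventually.of_forall fun g => ?_)
  rw [Real.norm_eq_abs, abs_of_nonneg (le_min (sq_nonneg _) hB)]
  exact min_le_right _ _

lemma integrable_jump_add (hz : Measurable z) {B : ℝ} (hB : 0 ≤ B) (a : ℝ) :
    Integrable (fun g => jump B (a + z g)) P := by
  refine Integrable.of_bound ((measurable_jump B).comp (hz.const_add a)).aestronglyMeasurable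
    (4 * B) (Filter.Eventually.of_forall fun g => ?_)
  rw [Real.norm_eq_abs, abs_of_nonneg (jump_nonneg hB _)]
  exact jump_le hB _

lemma integral_min_add_sq_le (hz : Measurable z) (h1 : Integrable z P) (h0 : ∫ g, z g ∂P = 0)
    (h2 : Integrable (fun g => z g ^ 2) P) {B : ℝ} (hB : 0 ≤ B) (a : ℝ) :
    ∫ g, min ((a + z g) ^ 2) B ∂P ≤ min (a ^ 2) B + min (∫ g, z g ^ 2 ∂P) B := by
  have hle1 : ∫ g, min ((a + z g) ^ 2) B ∂P ≤ a ^ 2 + ∫ g, z g ^ 2 ∂P := by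
    rw [← integral_add_sq h1 h0 h2]
    exact integral_mono (integrable_min_add_sq hz hB a) (integrable_add_sq h1 h2 a)
      fun g => min_le_left _ _
  have hle2 : ∫ g, min ((a + z g) ^ 2) B ∂P ≤ B := by
    calc ∫ g, min ((a + z g) ^ 2) B ∂P ≤ ∫ _, B ∂P :=
          integral_mono (integrable_min_add_sq hz hB a) (integrable_const _)
            fun g => min_le_right _ _
      _ = B := by simp
  have h3 : 0 ≤ ∫ g, z g ^ 2 ∂P := integral_nonneg fun g => sq_nonneg _
  -- Subadditivity of `· ∧ B` on nonnegative reals.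
  rcases min_cases (a ^ 2) B with h | h <;> rcases min_cases (∫ g, z g ^ 2 ∂P) B with h' | h' <;>
    rw [h.1, h'.1] <;> nlinarith [sq_nonneg a]

lemma le_integral_min_add_sq (hz : Measurable z) (h1 : Integrable z P) (h0 : ∫ g, z g ∂P = 0)
    (h2 : Integrable (fun g => z g ^ 2) P) (h4 : Integrable (fun g => z g ^ 4) P)
    {B : ℝ} (hB : 0 < B) {a : ℝ} (ha : 16 * a ^ 2 ≤ 9 * B) :
    a ^ 2 + ∫ g, z g ^ 2 ∂P ≤
      ∫ g, min ((a + z g) ^ 2) B ∂P + 256 / B * ∫ g, z g ^ 4 ∂P := by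
  rw [← integral_add_sq h1 h0 h2, ← integral_const_mul,
    ← integral_add (integrable_min_add_sq hz hB.le a) (h4.const_mul _)]
  exact integral_mono (integrable_add_sq h1 h2 a)
    ((integrable_min_add_sq hz hB.le a).add (h4.const_mul _)) fun g => sq_add_le_min_add hB ha _

lemma jump_le_two_mul_integral (hz : Measurable z)
    (hsymm : ∀ φ : ℝ → ℝ, ∫ g, φ (-z g) ∂P = ∫ g, φ (z g) ∂P) {B : ℝ} (hB : 0 ≤ B) (a : ℝ) :
    jump B a ≤ 2 * ∫ g, jump B (a + z g) ∂P := by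
  have h := hsymm fun y => jump B (a + y)
  calc jump B a = ∫ _, jump B a ∂P := by simp
    _ ≤ ∫ g, (jump B (a + z g) + jump B (a + -z g)) ∂P :=
        integral_mono (integrable_const _)
          ((integrable_jump_add hz hB a).add (integrable_jump_add hz.neg hB a))
          fun g => jump_le_jump_add_jump hB a (z g)
    _ = 2 * ∫ g, jump B (a + z g) ∂P := by
        have h' := integrable_jump_add (P := P) hz.neg hB a
        simp only [Pi.neg_apply] at h'
        rw [integral_add (integrable_jump_add hz hB a) h', h]
        ring

lemma integral_jump_le (hz : Measurable z) (h4 : Integrable (fun g => z g ^ 4) P)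
    {B : ℝ} (hB : 0 < B) (a : ℝ) :
    ∫ g, jump B (a + z g) ∂P ≤ far B a + 1024 / B * ∫ g, z g ^ 4 ∂P := by
  calc ∫ g, jump B (a + z g) ∂P ≤ ∫ g, (far B a + 1024 / B * z g ^ 4) ∂P :=
        integral_mono (integrable_jump_add hz hB.le a) ((integrable_const _).add (h4.const_mul _))
          fun g => jump_add_le_far_add hB a (z g)
    _ = _ := by
        rw [integral_add (integrable_const _) (h4.const_mul _), integral_const_mul]
        simp

lemma integral_add_pow_four_le (h4 : Integrable (fun g => z g ^ 4) P) (a : ℝ) :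
    ∫ g, (a + z g) ^ 4 ∂P ≤ 8 * (a ^ 4 + ∫ g, z g ^ 4 ∂P) := by
  calc ∫ g, (a + z g) ^ 4 ∂P ≤ ∫ g, (8 * a ^ 4 + 8 * z g ^ 4) ∂P := by
        refine integral_mono_of_nonneg (Filter.Eventually.of_forall fun g => ?_)
          ((integrable_const _).add (h4.const_mul _)) (Filter.Eventually.of_forall fun g => ?_)
        · simp only [Pi.zero_apply]; positivity
        · exact add_pow_four_le _ _
    _ = _ := by
        rw [integral_add (integrable_const _) (h4.const_mul _), integral_const_mul,
          integral_const_mul]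
        simp [mul_add]

end Truncation

/-! ### Bounded functions whose Gaussian averages sandwich the truncated square. -/

section Smoothing

/-- The variance of `⟨x, g⟩` when `g` has the law `gaussPrior E b`. -/
noncomputable def smoothVar {E : Type*} [NormedAddCommGroup E] (b : ℝ) (x : E) : ℝ :=
  ‖x‖ ^ 2 / (2 * b)

lemma smoothVar_nonneg {E : Type*} [NormedAddCommGroup E] {b : ℝ} (hb : 0 < b) (x : E) :
    0 ≤ smoothVar b x := by
  unfold smoothVar; positivity

variable {E : Type*} [NormedAddCommGroup E] [InnerProductSpace ℝ E]

/-- A function of `(x, θ)` whose average over Gaussian `θ` centred at `v` minorizes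
`⟨x, v⟩² ∧ B`. -/
noncomputable def truncLower (b B : ℝ) (x θ : E) : ℝ :=
  min (inner ℝ x θ ^ 2) B - min (smoothVar b x) B

/-- A function of `(x, θ)` whose average over Gaussian `θ` centred at `v` majorizes
`⟨x, v⟩² ∧ B`. -/
noncomputable def truncUpper (b B : ℝ) (x θ : E) : ℝ :=
  min (inner ℝ x θ ^ 2) B + jump B (inner ℝ x θ) - min (smoothVar b x) B
    + min (24576 / B * smoothVar b x ^ 2) (2 * B)

lemma abs_truncLower_le {b B : ℝ} (hb : 0 < b) (hB : 0 < B) (x θ : E) :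
    |truncLower b B x θ| ≤ 7 * B := by
  have h1 : 0 ≤ min (inner ℝ x θ ^ 2) B := le_min (sq_nonneg _) hB.le
  have h2 : 0 ≤ min (smoothVar b x) B := le_min (smoothVar_nonneg hb x) hB.le
  have h3 := min_le_right (inner ℝ x θ ^ 2) B
  have h4 := min_le_right (smoothVar b x) B
  unfold truncLower
  rw [abs_le]
  constructor <;> linarith

/-- `7B = B + 4B + 2B`; the cap `2B` on the correction is there to keep the function bounded. -/
lemma abs_truncUpper_le {b B : ℝ} (hb : 0 < b) (hB : 0 < B) (x θ : E) :
    |truncUpper b B x θ| ≤ 7 * B := by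
  have h1 : 0 ≤ min (inner ℝ x θ ^ 2) B := le_min (sq_nonneg _) hB.le
  have h2 : 0 ≤ min (smoothVar b x) B := le_min (smoothVar_nonneg hb x) hB.le
  have h3 := min_le_right (inner ℝ x θ ^ 2) B
  have h4 := min_le_right (smoothVar b x) B
  have h5 : 0 ≤ min (24576 / B * smoothVar b x ^ 2) (2 * B) := le_min (by positivity) (by linarith)
  have h6 := min_le_right (24576 / B * smoothVar b x ^ 2) (2 * B)
  have h7 := jump_nonneg hB.le (inner ℝ x θ)
  have h8 := jump_le hB.le (inner ℝ x θ)
  unfold truncUpper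
  rw [abs_le]
  constructor <;> linarith

lemma truncLower_sq_le {b B : ℝ} (hb : 0 < b) (hB : 0 < B) (x θ : E) :
    truncLower b B x θ ^ 2 ≤ 243 * inner ℝ x θ ^ 4 + 147459 * smoothVar b x ^ 2 := by
  have h1 : 0 ≤ min (inner ℝ x θ ^ 2) B := le_min (sq_nonneg _) hB.le
  have h2 : 0 ≤ min (smoothVar b x) B := le_min (smoothVar_nonneg hb x) hB.le
  have h3 := min_le_left (inner ℝ x θ ^ 2) B
  have h4 := min_le_left (smoothVar b x) B
  have h5 := pow_le_pow_left₀ h1 h3 2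
  have h6 := pow_le_pow_left₀ h2 h4 2
  unfold truncLower
  generalize min (inner ℝ x θ ^ 2) B = u at *
  generalize min (smoothVar b x) B = s at *
  have h7 : (u - s) ^ 2 ≤ 2 * u ^ 2 + 2 * s ^ 2 := by nlinarith [sq_nonneg (u + s)]
  nlinarith [sq_nonneg (inner ℝ x θ ^ 2), sq_nonneg (smoothVar b x)]

/-- The square of the capped correction is bounded by the product of its two arguments, where `B`
cancels: `2 · 24576 = 49152`. Then `243 = 3 · 9²` and `147459 = 3 + 3 · 49152`. -/
lemma truncUpper_sq_le {b B : ℝ} (hb : 0 < b) (hB : 0 < B) (x θ : E) :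
    truncUpper b B x θ ^ 2 ≤ 243 * inner ℝ x θ ^ 4 + 147459 * smoothVar b x ^ 2 := by
  have h0 : 0 ≤ min (inner ℝ x θ ^ 2) B := le_min (sq_nonneg _) hB.le
  have h1 : 0 ≤ min (inner ℝ x θ ^ 2) B + jump B (inner ℝ x θ) :=
    add_nonneg h0 (jump_nonneg hB.le _)
  have h2 : 0 ≤ min (smoothVar b x) B := le_min (smoothVar_nonneg hb x) hB.le
  have h3 : min (inner ℝ x θ ^ 2) B + jump B (inner ℝ x θ) ≤ 9 * inner ℝ x θ ^ 2 := by
    linarith [min_le_left (inner ℝ x θ ^ 2) B, jump_le_sq (B := B) (inner ℝ x θ)]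
  have h4 := min_le_left (smoothVar b x) B
  have h5 := pow_le_pow_left₀ h1 h3 2
  have h6 := pow_le_pow_left₀ h2 h4 2
  have h7 : min (24576 / B * smoothVar b x ^ 2) (2 * B) ^ 2 ≤ 49152 * smoothVar b x ^ 2 := by
    have h8 : 0 ≤ min (24576 / B * smoothVar b x ^ 2) (2 * B) :=
      le_min (by positivity) (by linarith)
    calc min (24576 / B * smoothVar b x ^ 2) (2 * B) ^ 2
        = min (24576 / B * smoothVar b x ^ 2) (2 * B) *
          min (24576 / B * smoothVar b x ^ 2) (2 * B) := sq _
      _ ≤ (24576 / B * smoothVar b x ^ 2) * (2 * B) :=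
          mul_le_mul (min_le_left _ _) (min_le_right _ _) h8 (by positivity)
      _ = 49152 * smoothVar b x ^ 2 := by field_simp; ring
  unfold truncUpper
  generalize min (inner ℝ x θ ^ 2) B + jump B (inner ℝ x θ) = u at *
  generalize min (smoothVar b x) B = s at *
  generalize min (24576 / B * smoothVar b x ^ 2) (2 * B) = r at *
  have h8 : (u - s + r) ^ 2 ≤ 3 * u ^ 2 + 3 * s ^ 2 + 3 * r ^ 2 := by
    nlinarith [sq_nonneg (u + s), sq_nonneg (u - r), sq_nonneg (s + r)]
  nlinarith

variable [MeasurableSpace E] [BorelSpace E]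

lemma measurable_uncurry_inner [SecondCountableTopology E] :
    Measurable fun p : E × E => inner ℝ p.1 p.2 := by fun_prop

lemma measurable_truncLower [SecondCountableTopology E] (b B : ℝ) :
    Measurable (Function.uncurry (truncLower (E := E) b B)) := by
  unfold truncLower smoothVar Function.uncurry
  fun_prop

lemma measurable_truncUpper [SecondCountableTopology E] (b B : ℝ) :
    Measurable (Function.uncurry (truncUpper (E := E) b B)) := by
  have h : Measurable fun p : E × E => jump B (inner ℝ p.1 p.2) :=
    (measurable_jump B).comp measurable_uncurry_inner
  unfold truncUpper smoothVar Function.uncurry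
  fun_prop

variable [FiniteDimensional ℝ E] {b B : ℝ}

lemma integral_truncLower (hb : 0 < b) (hB : 0 < B) (x v : E) :
    ∫ g, truncLower b B x (v + g) ∂(gaussPrior E b) =
      ∫ g, min ((inner ℝ x v + inner ℝ x g) ^ 2) B ∂(gaussPrior E b)
        - min (smoothVar b x) B := by
  have := isProbabilityMeasure_gaussPrior (E := E) hb
  simp only [truncLower, inner_add_right]
  rw [integral_sub (integrable_min_add_sq (by fun_prop) hB.le _) (integrable_const _)]
  simp

lemma integral_truncUpper (hb : 0 < b) (hB : 0 < B) (x v : E) :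
    ∫ g, truncUpper b B x (v + g) ∂(gaussPrior E b) =
      ∫ g, min ((inner ℝ x v + inner ℝ x g) ^ 2) B ∂(gaussPrior E b)
        + ∫ g, jump B (inner ℝ x v + inner ℝ x g) ∂(gaussPrior E b)
        - min (smoothVar b x) B + min (24576 / B * smoothVar b x ^ 2) (2 * B) := by
  have := isProbabilityMeasure_gaussPrior (E := E) hb
  have hz : Measurable fun g : E => inner ℝ x g := by fun_prop
  have h1 := integrable_min_add_sq (P := gaussPrior E b) hz hB.le (inner ℝ x v)
  have h2 := integrable_jump_add (P := gaussPrior E b) hz hB.le (inner ℝ x v)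
  have h3 : Integrable (fun g => min ((inner ℝ x v + inner ℝ x g) ^ 2) B
      + jump B (inner ℝ x v + inner ℝ x g)) (gaussPrior E b) := h1.add h2
  have h4 : Integrable (fun g => min ((inner ℝ x v + inner ℝ x g) ^ 2) B
      + jump B (inner ℝ x v + inner ℝ x g) - min (smoothVar b x) B) (gaussPrior E b) :=
    h3.sub (integrable_const _)
  simp only [truncUpper, inner_add_right]
  rw [integral_add h4 (integrable_const _), integral_sub h3 (integrable_const _),
    integral_add h1 h2]
  simp

lemma integral_truncLower_le (hb : 0 < b) (hB : 0 < B) (x v : E) :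
    ∫ g, truncLower b B x (v + g) ∂(gaussPrior E b) ≤ min (inner ℝ x v ^ 2) B := by
  have := isProbabilityMeasure_gaussPrior (E := E) hb
  have h := integral_min_add_sq_le (P := gaussPrior E b) (z := fun g => inner ℝ x g)
    (by fun_prop) (by simpa using integrable_inner_pow_gaussPrior hb x 1)
    (integral_inner_gaussPrior hb x) (integrable_inner_pow_gaussPrior hb x 2) hB.le (inner ℝ x v)
  rw [integral_inner_sq_gaussPrior hb] at h
  rw [integral_truncLower hb hB, smoothVar]
  linarith

/-- Here `24576 = 256 · 96`: the truncation loss times the Gaussian fourth-moment bound. -/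
lemma min_add_smoothVar_le (hb : 0 < b) (hB : 0 < B) (x v : E)
    (h : 16 * inner ℝ x v ^ 2 ≤ 9 * B) :
    min (inner ℝ x v ^ 2) B + min (smoothVar b x) B ≤
      ∫ g, min ((inner ℝ x v + inner ℝ x g) ^ 2) B ∂(gaussPrior E b)
        + 24576 / B * smoothVar b x ^ 2 := by
  have := isProbabilityMeasure_gaussPrior (E := E) hb
  have h1 := le_integral_min_add_sq (P := gaussPrior E b) (z := fun g => inner ℝ x g)
    (by fun_prop) (by simpa using integrable_inner_pow_gaussPrior hb x 1)
    (integral_inner_gaussPrior hb x) (integrable_inner_pow_gaussPrior hb x 2)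
    (integrable_inner_pow_gaussPrior hb x 4) hB h
  rw [integral_inner_sq_gaussPrior hb] at h1
  have h2 := mul_le_mul_of_nonneg_left (integral_inner_pow_four_gaussPrior_le hb x)
    (by positivity : 0 ≤ 256 / B)
  have h3 : 256 / B * (96 * (‖x‖ ^ 2 / (2 * b)) ^ 2) = 24576 / B * smoothVar b x ^ 2 := by
    rw [smoothVar]; ring
  have h4 := min_le_left (inner ℝ x v ^ 2) B
  have h5 := min_le_left (smoothVar b x) B
  rw [smoothVar] at h5 ⊢
  rw [smoothVar] at h3
  linarith

lemma min_le_integral_truncLower_add (hb : 0 < b) (hB : 0 < B) (x v : E) :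
    min (inner ℝ x v ^ 2) B ≤ ∫ g, truncLower b B x (v + g) ∂(gaussPrior E b)
      + (far B (inner ℝ x v) + 24576 / B * smoothVar b x ^ 2) := by
  have := isProbabilityMeasure_gaussPrior (E := E) hb
  rw [integral_truncLower hb hB]
  have h0 : 0 ≤ ∫ g, min ((inner ℝ x v + inner ℝ x g) ^ 2) B ∂(gaussPrior E b) :=
    integral_nonneg fun g => le_min (sq_nonneg _) hB.le
  by_cases h : 16 * inner ℝ x v ^ 2 ≤ 9 * B
  · linarith [min_add_smoothVar_le hb hB x v h, far_nonneg hB.le (inner ℝ x v)]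
  · have h1 : far B (inner ℝ x v) = 4 * B := if_pos (by linarith)
    have h2 : 0 ≤ 24576 / B * smoothVar b x ^ 2 := by positivity
    linarith [min_le_right (inner ℝ x v ^ 2) B, min_le_right (smoothVar b x) B]

lemma min_le_integral_truncUpper (hb : 0 < b) (hB : 0 < B) (x v : E) :
    min (inner ℝ x v ^ 2) B ≤ ∫ g, truncUpper b B x (v + g) ∂(gaussPrior E b) := by
  have := isProbabilityMeasure_gaussPrior (E := E) hb
  rw [integral_truncUpper hb hB]
  have h0 : 0 ≤ ∫ g, min ((inner ℝ x v + inner ℝ x g) ^ 2) B ∂(gaussPrior E b) :=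
    integral_nonneg fun g => le_min (sq_nonneg _) hB.le
  have h1 : 0 ≤ ∫ g, jump B (inner ℝ x v + inner ℝ x g) ∂(gaussPrior E b) :=
    integral_nonneg fun g => jump_nonneg hB.le _
  have h2 := min_le_right (inner ℝ x v ^ 2) B
  have h3 := min_le_right (smoothVar b x) B
  by_cases h : 16 * inner ℝ x v ^ 2 ≤ 9 * B
  · have h4 := min_add_smoothVar_le hb hB x v h
    -- If the cap `2B` is active, it already dominates the sum of the two minima, each at most `B`.
    rcases min_cases (24576 / B * smoothVar b x ^ 2) (2 * B) with h5 | h5 <;> linarith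
  -- For large `⟨x, v⟩`, symmetry retains half of the weight `4B`, that is `2B`, enough for both
  -- minima.
  · have h4 := jump_le_two_mul_integral (P := gaussPrior E b) (z := fun g => inner ℝ x g)
      (by fun_prop) (fun φ => by
        have := integral_comp_neg_gaussPrior hb fun g : E => φ (inner ℝ x g)
        simpa only [inner_neg_right] using this) hB.le (inner ℝ x v)
    have h5 : jump B (inner ℝ x v) = 4 * B := if_pos (by linarith)
    have h6 : 0 ≤ min (24576 / B * smoothVar b x ^ 2) (2 * B) :=
      le_min (by positivity) (by linarith)
    linarith

/-- The bias collects `1024 · 96` from the smoothed `jump` and `24576` from the correction, in total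
`122880`. -/
lemma integral_truncUpper_le (hb : 0 < b) (hB : 0 < B) (x v : E) :
    ∫ g, truncUpper b B x (v + g) ∂(gaussPrior E b) ≤ min (inner ℝ x v ^ 2) B
      + (far B (inner ℝ x v) + 122880 / B * smoothVar b x ^ 2) := by
  have := isProbabilityMeasure_gaussPrior (E := E) hb
  have h := integral_truncLower_le hb hB x v
  rw [integral_truncLower hb hB] at h
  have h1 := integral_jump_le (P := gaussPrior E b) (z := fun g => inner ℝ x g)
    (by fun_prop) (integrable_inner_pow_gaussPrior hb x 4) hB (inner ℝ x v)
  have h2 := mul_le_mul_of_nonneg_left (integral_inner_pow_four_gaussPrior_le hb x)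
    (by positivity : 0 ≤ 1024 / B)
  have h3 : 1024 / B * (96 * (‖x‖ ^ 2 / (2 * b)) ^ 2) + 24576 / B * smoothVar b x ^ 2
      = 122880 / B * smoothVar b x ^ 2 := by
    rw [smoothVar]; ring
  have h4 := min_le_left (24576 / B * smoothVar b x ^ 2) (2 * B)
  rw [integral_truncUpper hb hB]
  linarith

lemma integral_sq_le_of_sq_le (hb : 0 < b) {F : E → E → ℝ}
    (hF : ∀ x θ, F x θ ^ 2 ≤ 243 * inner ℝ x θ ^ 4 + 147459 * smoothVar b x ^ 2) (x v : E) :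
    ∫ g, F x (v + g) ^ 2 ∂(gaussPrior E b) ≤
      10 ^ 6 * (inner ℝ x v ^ 4 + smoothVar b x ^ 2) := by
  have := isProbabilityMeasure_gaussPrior (E := E) hb
  have h4 := integrable_inner_pow_gaussPrior hb x 4
  have hi : Integrable (fun g => (inner ℝ x v + inner ℝ x g) ^ 4) (gaussPrior E b) := by
    refine Integrable.mono' (((integrable_const (8 * inner ℝ x v ^ 4)).add (h4.const_mul 8)))
      (by fun_prop) (Filter.Eventually.of_forall fun g => ?_)
    rw [Real.norm_eq_abs, abs_of_nonneg (by positivity)]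
    exact add_pow_four_le _ _
  calc ∫ g, F x (v + g) ^ 2 ∂(gaussPrior E b)
      ≤ ∫ g, (243 * (inner ℝ x v + inner ℝ x g) ^ 4 + 147459 * smoothVar b x ^ 2)
          ∂(gaussPrior E b) := by
        refine integral_mono_of_nonneg (Filter.Eventually.of_forall fun g => sq_nonneg _)
          ((hi.const_mul _).add (integrable_const _)) (Filter.Eventually.of_forall fun g => ?_)
        have := hF x (v + g)
        rwa [inner_add_right] at this
    _ = 243 * ∫ g, (inner ℝ x v + inner ℝ x g) ^ 4 ∂(gaussPrior E b)
          + 147459 * smoothVar b x ^ 2 := by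
        rw [integral_add (hi.const_mul _) (integrable_const _), integral_const_mul]
        simp
    _ ≤ 243 * (8 * (inner ℝ x v ^ 4 + 96 * smoothVar b x ^ 2))
          + 147459 * smoothVar b x ^ 2 := by
        gcongr
        exact (integral_add_pow_four_le h4 _).trans
          (by gcongr; exact integral_inner_pow_four_gaussPrior_le hb x)
    _ ≤ _ := by nlinarith [sq_nonneg (inner ℝ x v ^ 2), sq_nonneg (smoothVar b x)]

end Smoothing

/-! ### Covariance, directional moments and the fourth moment of the norm. -/

section Moments

variable {Ω : Type*} [MeasurableSpace Ω] {μ : Measure Ω} {d : ℕ}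
  {X : Ω → EuclideanSpace ℝ (Fin d)}

lemma integrable_abs_inner_rpow (hX : AEMeasurable X μ) {q : ℝ} (hq : 0 ≤ q)
    (hint : Integrable (fun ω => ‖X ω‖ ^ q) μ) (v : EuclideanSpace ℝ (Fin d)) :
    Integrable (fun ω => |inner ℝ (X ω) v| ^ q) μ := by
  have hm : AEMeasurable (fun ω => |inner ℝ (X ω) v| ^ q) μ := by fun_prop
  refine Integrable.mono' (hint.mul_const (‖v‖ ^ q)) hm.aestronglyMeasurable
    (Filter.Eventually.of_forall fun ω => ?_)
  rw [Real.norm_eq_abs, abs_of_nonneg (by positivity),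
    ← Real.mul_rpow (by positivity) (by positivity)]
  exact Real.rpow_le_rpow (abs_nonneg _) (abs_real_inner_le_norm _ _) hq

lemma kappa_nonneg (q : ℝ) : 0 ≤ kappa X μ q :=
  Real.iSup_nonneg fun v => Real.rpow_nonneg (integral_nonneg fun ω => by positivity) _

lemma memLp_inner_two (hX : AEMeasurable X μ) (hint : Integrable (fun ω => ‖X ω‖ ^ (2 : ℝ)) μ)
    (v : EuclideanSpace ℝ (Fin d)) : MemLp (fun ω => inner ℝ (X ω) v) 2 μ := by
  have hm : AEMeasurable (fun ω => inner ℝ (X ω) v) μ := by fun_prop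
  rw [memLp_two_iff_integrable_sq hm.aestronglyMeasurable]
  simpa using integrable_abs_inner_rpow hX (by norm_num) hint v

lemma integrable_inner_pow_four (hX : AEMeasurable X μ)
    (hint : Integrable (fun ω => ‖X ω‖ ^ (4 : ℝ)) μ) (v : EuclideanSpace ℝ (Fin d)) :
    Integrable (fun ω => inner ℝ (X ω) v ^ 4) μ := by
  refine (integrable_abs_inner_rpow hX (by norm_num) hint v).congr
    (Filter.Eventually.of_forall fun ω => ?_)
  simp only
  rw [show (4 : ℝ) = ((4 : ℕ) : ℝ) by norm_num, Real.rpow_natCast, Even.pow_abs (by decide)]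

lemma memLp_apply_two (hX : AEMeasurable X μ) (hint : Integrable (fun ω => ‖X ω‖ ^ (2 : ℝ)) μ)
    (i : Fin d) : MemLp (fun ω => X ω i) 2 μ := by
  simpa [EuclideanSpace.inner_single_right] using
    memLp_inner_two hX hint (EuclideanSpace.single i (1 : ℝ))

variable [IsProbabilityMeasure μ]

lemma integrable_norm_rpow_of_le (hX : AEMeasurable X μ) {p q : ℝ} (hq : 0 ≤ q) (hqp : q ≤ p)
    (hint : Integrable (fun ω => ‖X ω‖ ^ p) μ) : Integrable (fun ω => ‖X ω‖ ^ q) μ := by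
  refine Integrable.mono' ((integrable_const 1).add hint)
    (hX.norm.pow_const q).aestronglyMeasurable (Filter.Eventually.of_forall fun ω => ?_)
  have h0 : 0 ≤ ‖X ω‖ := norm_nonneg _
  rw [Real.norm_eq_abs, abs_of_nonneg (by positivity), Pi.add_apply]
  rcases le_total ‖X ω‖ 1 with h | h
  · have h1 := Real.rpow_le_one h0 h hq
    have h2 : 0 ≤ ‖X ω‖ ^ p := by positivity
    linarith
  · have := Real.rpow_le_rpow_of_exponent_le h hqp
    linarith

lemma integrable_of_integrable_norm_sq (hX : AEMeasurable X μ)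
    (hint : Integrable (fun ω => ‖X ω‖ ^ (2 : ℝ)) μ) : Integrable X μ := by
  have := integrable_norm_rpow_of_le hX (by norm_num) (by norm_num : (1 : ℝ) ≤ 2) hint
  simp only [Real.rpow_one] at this
  exact (integrable_norm_iff hX.aestronglyMeasurable).1 this

lemma integral_apply_eq_zero (hX : AEMeasurable X μ)
    (hint : Integrable (fun ω => ‖X ω‖ ^ (2 : ℝ)) μ) (h0 : ∫ ω, X ω ∂μ = 0) (i : Fin d) :
    ∫ ω, X ω i ∂μ = 0 := by
  have h := integral_inner (𝕜 := ℝ) (integrable_of_integrable_norm_sq hX hint)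
    (EuclideanSpace.single i (1 : ℝ))
  simpa [EuclideanSpace.inner_single_left, h0] using h

lemma covMat_apply (hX : AEMeasurable X μ) (hint : Integrable (fun ω => ‖X ω‖ ^ (2 : ℝ)) μ)
    (h0 : ∫ ω, X ω ∂μ = 0) (i j : Fin d) : covMat X μ i j = ∫ ω, X ω i * X ω j ∂μ := by
  rw [covMat, Matrix.of_apply, covariance_eq_sub (memLp_apply_two hX hint i)
    (memLp_apply_two hX hint j), integral_apply_eq_zero hX hint h0]
  simp

lemma inner_covMat (hX : AEMeasurable X μ) (hint : Integrable (fun ω => ‖X ω‖ ^ (2 : ℝ)) μ)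
    (h0 : ∫ ω, X ω ∂μ = 0) (u v : EuclideanSpace ℝ (Fin d)) :
    inner ℝ u (Matrix.toEuclideanCLM (n := Fin d) (𝕜 := ℝ) (covMat X μ) v) =
      ∫ ω, inner ℝ (X ω) u * inner ℝ (X ω) v ∂μ := by
  have hi : ∀ i j, Integrable (fun ω => X ω i * X ω j) μ := fun i j =>
    (memLp_apply_two hX hint i).integrable_mul (memLp_apply_two hX hint j)
  have h1 : ∀ ω, inner ℝ (X ω) u * inner ℝ (X ω) v =
      ∑ i, ∑ j, (X ω i * X ω j) * (u i * v j) := by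
    intro ω
    simp only [PiLp.inner_apply, RCLike.inner_apply, conj_trivial]
    rw [Finset.sum_mul_sum]
    refine Finset.sum_congr rfl fun i _ => Finset.sum_congr rfl fun j _ => by ring
  simp_rw [h1]
  rw [integral_finsetSum _ fun i _ => integrable_finsetSum _ fun j _ => (hi i j).mul_const _]
  simp_rw [integral_finsetSum _ fun j _ => (hi _ j).mul_const _, integral_mul_const,
    ← covMat_apply hX hint h0]
  simp only [PiLp.inner_apply, RCLike.inner_apply, conj_trivial, Matrix.ofLp_toEuclideanCLM,
    Matrix.mulVec, dotProduct, Finset.sum_mul]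
  refine Finset.sum_congr rfl fun i _ => Finset.sum_congr rfl fun j _ => by ring

lemma quadForm_covMat (hX : AEMeasurable X μ) (hint : Integrable (fun ω => ‖X ω‖ ^ (2 : ℝ)) μ)
    (h0 : ∫ ω, X ω ∂μ = 0) (v : EuclideanSpace ℝ (Fin d)) :
    quadForm (covMat X μ) v = ∫ ω, inner ℝ (X ω) v ^ 2 ∂μ := by
  rw [quadForm, inner_covMat hX hint h0]
  simp_rw [sq]

lemma quadForm_le {M : Matrix (Fin d) (Fin d) ℝ} (v : EuclideanSpace ℝ (Fin d)) :
    quadForm M v ≤ opNorm M * ‖v‖ ^ 2 := by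
  rw [quadForm, opNorm]
  calc inner ℝ v (Matrix.toEuclideanCLM (n := Fin d) (𝕜 := ℝ) M v)
      ≤ ‖v‖ * ‖Matrix.toEuclideanCLM (n := Fin d) (𝕜 := ℝ) M v‖ := real_inner_le_norm _ _
    _ ≤ ‖v‖ * (‖Matrix.toEuclideanCLM (n := Fin d) (𝕜 := ℝ) M‖ * ‖v‖) := by
        gcongr; exact ContinuousLinearMap.le_opNorm _ _
    _ = _ := by ring

lemma opNorm_pos {M : Matrix (Fin d) (Fin d) ℝ} (hM : M ≠ 0) : 0 < opNorm M := by
  rw [opNorm, norm_pos_iff]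
  simpa using hM

lemma inner_ae_eq_zero (hX : AEMeasurable X μ) (hint : Integrable (fun ω => ‖X ω‖ ^ (2 : ℝ)) μ)
    (h0 : ∫ ω, X ω ∂μ = 0) {v : EuclideanSpace ℝ (Fin d)} (hv : quadForm (covMat X μ) v = 0) :
    ∀ᵐ ω ∂μ, inner ℝ (X ω) v = 0 := by
  rw [quadForm_covMat hX hint h0, integral_eq_zero_iff_of_nonneg (fun ω => sq_nonneg _)
    (memLp_inner_two hX hint v).integrable_sq] at hv
  filter_upwards [hv] with ω hω
  simpa using hω

/-- With `u = Σw`, one has `‖u‖² = E⟨X, u⟩⟨X, w⟩`. The weighted inequality `ac ≤ a²/(2T) + Tc²/2`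
with `T = ‖Σ‖` bounds this by `‖u‖²/2 + T/2`. -/
lemma norm_covMat_apply_sq_le (hX : AEMeasurable X μ)
    (hint : Integrable (fun ω => ‖X ω‖ ^ (2 : ℝ)) μ) (h0 : ∫ ω, X ω ∂μ = 0)
    {w : EuclideanSpace ℝ (Fin d)} (hw : quadForm (covMat X μ) w = 1) :
    ‖Matrix.toEuclideanCLM (n := Fin d) (𝕜 := ℝ) (covMat X μ) w‖ ^ 2 ≤ opNorm (covMat X μ) := by
  set u := Matrix.toEuclideanCLM (n := Fin d) (𝕜 := ℝ) (covMat X μ) w with hu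
  have hT : 0 < opNorm (covMat X μ) := by
    apply opNorm_pos
    intro h
    simp [quadForm, h] at hw
  set T := opNorm (covMat X μ)
  have h1 : ‖u‖ ^ 2 = ∫ ω, inner ℝ (X ω) u * inner ℝ (X ω) w ∂μ := by
    rw [← inner_covMat hX hint h0, ← hu, real_inner_self_eq_norm_sq]
  have hiu := (memLp_inner_two hX hint u).integrable_sq
  have hiw := (memLp_inner_two hX hint w).integrable_sq
  have h2 : ∫ ω, inner ℝ (X ω) u * inner ℝ (X ω) w ∂μ ≤
      ∫ ω, (1 / (2 * T) * inner ℝ (X ω) u ^ 2 + T / 2 * inner ℝ (X ω) w ^ 2) ∂μ := by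
    refine integral_mono ((memLp_inner_two hX hint u).integrable_mul (memLp_inner_two hX hint w))
      ((hiu.const_mul _).add (hiw.const_mul _)) fun ω => ?_
    simp only
    generalize inner ℝ (X ω) u = a
    generalize inner ℝ (X ω) w = c
    have : 1 / (2 * T) * a ^ 2 + T / 2 * c ^ 2 - a * c = (a - T * c) ^ 2 / (2 * T) := by
      field_simp; ring
    have h3 : 0 ≤ (a - T * c) ^ 2 / (2 * T) := by positivity
    linarith
  rw [integral_add (hiu.const_mul _) (hiw.const_mul _), integral_const_mul, integral_const_mul,
    ← quadForm_covMat hX hint h0, ← quadForm_covMat hX hint h0, hw, ← h1] at h2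
  have h4 : 1 / (2 * T) * quadForm (covMat X μ) u ≤ 1 / (2 * T) * (T * ‖u‖ ^ 2) := by
    gcongr
    exact quadForm_le u
  have h5 : 1 / (2 * T) * (T * ‖u‖ ^ 2) = ‖u‖ ^ 2 / 2 := by field_simp
  linarith

/-- The constraint set is unbounded when `Σ` is singular, but `X` is almost surely orthogonal to
`ker Σ`. Only the component `w` in the orthogonal complement matters; there `Σ` is injective, so
`‖w‖ ≤ c‖Σw‖ ≤ c√‖Σ‖`. Without boundedness the real supremum would default to 0 and give no moment
bound. -/
lemma bddAbove_kappa (hX : AEMeasurable X μ) {q : ℝ} (hq : 2 ≤ q)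
    (hint : Integrable (fun ω => ‖X ω‖ ^ q) μ) (h0 : ∫ ω, X ω ∂μ = 0) :
    BddAbove (Set.range fun v : {v : EuclideanSpace ℝ (Fin d) // quadForm (covMat X μ) v = 1} =>
      (∫ ω, |inner ℝ (X ω) v.1| ^ q ∂μ) ^ (1 / q)) := by
  have hint2 := integrable_norm_rpow_of_le hX (by norm_num) hq hint
  set A := Matrix.toEuclideanCLM (n := Fin d) (𝕜 := ℝ) (covMat X μ) with hA
  set K := LinearMap.ker (A : EuclideanSpace ℝ (Fin d) →ₗ[ℝ] EuclideanSpace ℝ (Fin d)) with hK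
  obtain ⟨c, -, hc⟩ := LinearMap.exists_antilipschitzWith
    ((A : EuclideanSpace ℝ (Fin d) →ₗ[ℝ] EuclideanSpace ℝ (Fin d)).comp Kᗮ.subtype) (by
      rw [LinearMap.ker_eq_bot']
      intro w hw
      have h1 : (w : EuclideanSpace ℝ (Fin d)) ∈ K := by simpa [hK] using hw
      have h2 := Submodule.inner_right_of_mem_orthogonal h1 w.2
      rw [inner_self_eq_zero] at h2
      exact Subtype.ext h2)
  refine ⟨(∫ ω, ‖X ω‖ ^ q * (c * √(opNorm (covMat X μ))) ^ q ∂μ) ^ (1 / q), ?_⟩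
  rintro _ ⟨⟨v, hv⟩, rfl⟩
  simp only
  obtain ⟨k, hk, w, hw, rfl⟩ := K.exists_add_mem_mem_orthogonal v
  have hAk : A k = 0 := by simpa [hK] using hk
  have hqk : quadForm (covMat X μ) k = 0 := by
    rw [quadForm, ← hA, hAk, inner_zero_right]
  have hk0 := inner_ae_eq_zero hX hint2 h0 hqk
  have hqw : quadForm (covMat X μ) w = 1 := by
    rw [← hv, quadForm_covMat hX hint2 h0, quadForm_covMat hX hint2 h0]
    refine integral_congr_ae ?_
    filter_upwards [hk0] with ω hω
    rw [inner_add_right, hω, zero_add]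
  have hwn : ‖w‖ ≤ c * √(opNorm (covMat X μ)) := by
    have h1 := hc.le_mul_norm_sub (x := 0) (y := ⟨w, hw⟩)
    simp only [neg_zero, zero_add, map_zero, LinearMap.comp_apply] at h1
    have h2 : ‖A w‖ ≤ √(opNorm (covMat X μ)) :=
      Real.le_sqrt_of_sq_le (norm_covMat_apply_sq_le hX hint2 h0 hqw)
    calc ‖w‖ ≤ c * ‖A w‖ := h1
      _ ≤ _ := by gcongr
  refine Real.rpow_le_rpow (integral_nonneg fun ω => by positivity) ?_ (by positivity)
  refine integral_mono_ae (integrable_abs_inner_rpow hX (by linarith) hint _)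
    (hint.mul_const _) ?_
  filter_upwards [hk0] with ω hω
  rw [inner_add_right, hω, zero_add, ← Real.mul_rpow (by positivity) (by positivity)]
  exact Real.rpow_le_rpow (abs_nonneg _)
    ((abs_real_inner_le_norm _ _).trans (by gcongr)) (by linarith)

lemma quadForm_covMat_nonneg (hX : AEMeasurable X μ)
    (hint : Integrable (fun ω => ‖X ω‖ ^ (2 : ℝ)) μ) (h0 : ∫ ω, X ω ∂μ = 0)
    (v : EuclideanSpace ℝ (Fin d)) : 0 ≤ quadForm (covMat X μ) v := by
  rw [quadForm_covMat hX hint h0]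
  exact integral_nonneg fun ω => sq_nonneg _

lemma quadForm_smul (M : Matrix (Fin d) (Fin d) ℝ) (a : ℝ) (v : EuclideanSpace ℝ (Fin d)) :
    quadForm M (a • v) = a ^ 2 * quadForm M v := by
  rw [quadForm, quadForm, map_smul, inner_smul_left, inner_smul_right]
  simp only [conj_trivial]
  ring

/-- The moment bound encoded by `kappa`. -/
lemma integral_abs_inner_rpow_le (hX : AEMeasurable X μ) {q : ℝ} (hq : 2 ≤ q)
    (hint : Integrable (fun ω => ‖X ω‖ ^ q) μ) (h0 : ∫ ω, X ω ∂μ = 0)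
    (v : EuclideanSpace ℝ (Fin d)) :
    ∫ ω, |inner ℝ (X ω) v| ^ q ∂μ ≤
      kappa X μ q ^ q * quadForm (covMat X μ) v ^ (q / 2) := by
  have hint2 := integrable_norm_rpow_of_le hX (by norm_num) hq hint
  have hq0 : 0 < q := by linarith
  have hκ := kappa_nonneg (X := X) (μ := μ) q
  rcases (quadForm_covMat_nonneg hX hint2 h0 v).eq_or_lt with h | h
  · have h1 : ∫ ω, |inner ℝ (X ω) v| ^ q ∂μ = 0 := by
      rw [← integral_zero Ω ℝ (μ := μ)]
      refine integral_congr_ae ?_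
      filter_upwards [inner_ae_eq_zero hX hint2 h0 h.symm] with ω hω
      rw [hω, abs_zero, Real.zero_rpow hq0.ne']
    rw [h1]
    have := quadForm_covMat_nonneg hX hint2 h0 v
    positivity
  · set s := quadForm (covMat X μ) v with hs
    have hv1 : quadForm (covMat X μ) ((√s)⁻¹ • v) = 1 := by
      rw [quadForm_smul, inv_pow, Real.sq_sqrt h.le, ← hs, inv_mul_cancel₀ h.ne']
    have h1 := le_ciSup (bddAbove_kappa hX hq hint h0) ⟨_, hv1⟩
    have h2 := Real.rpow_le_rpow (Real.rpow_nonneg (integral_nonneg fun ω => by positivity) _) h1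
      hq0.le
    rw [← Real.rpow_mul (integral_nonneg fun ω => by positivity), one_div_mul_cancel hq0.ne',
      Real.rpow_one] at h2
    simp only [inner_smul_right, abs_mul] at h2
    simp_rw [Real.mul_rpow (abs_nonneg (√s)⁻¹) (abs_nonneg _)] at h2
    rw [integral_const_mul, abs_of_nonneg (by positivity), Real.inv_rpow (by positivity),
      Real.sqrt_eq_rpow, ← Real.rpow_mul h.le,
      inv_mul_le_iff₀ (by positivity), one_div_mul_eq_div] at h2
    rw [mul_comm]
    exact h2

lemma integral_inner_pow_four_le (hX : AEMeasurable X μ)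
    (hint : Integrable (fun ω => ‖X ω‖ ^ (4 : ℝ)) μ) (h0 : ∫ ω, X ω ∂μ = 0)
    (v : EuclideanSpace ℝ (Fin d)) :
    ∫ ω, inner ℝ (X ω) v ^ 4 ∂μ ≤ kappa X μ 4 ^ 4 * quadForm (covMat X μ) v ^ 2 := by
  have h := integral_abs_inner_rpow_le hX (by norm_num) hint h0 v
  have h1 : ∀ y : ℝ, |y| ^ (4 : ℝ) = y ^ 4 := fun y => by
    rw [show (4 : ℝ) = ((4 : ℕ) : ℝ) by norm_num, Real.rpow_natCast,
      Even.pow_abs (by decide)]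
  simp_rw [h1] at h
  have h2 : kappa X μ 4 ^ (4 : ℝ) = kappa X μ 4 ^ 4 := by
    rw [← h1, abs_of_nonneg (kappa_nonneg _)]
  rw [h2, show (4 / 2 : ℝ) = ((2 : ℕ) : ℝ) by norm_num, Real.rpow_natCast] at h
  exact h

/-- Cauchy-Schwarz with weights `a i = Σ_ii` gives `‖X‖⁴ ≤ (∑ a i) ∑ X_i⁴ / a i`, and the
directional bound `E X_i⁴ ≤ κ₄⁴ (a i)²` absorbs the denominators. -/
lemma integral_norm_pow_four_le (hX : AEMeasurable X μ)
    (hint : Integrable (fun ω => ‖X ω‖ ^ (4 : ℝ)) μ) (h0 : ∫ ω, X ω ∂μ = 0) :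
    ∫ ω, ‖X ω‖ ^ 4 ∂μ ≤ kappa X μ 4 ^ 4 * (covMat X μ).trace ^ 2 := by
  have hint2 := integrable_norm_rpow_of_le hX (by norm_num) (by norm_num : (2 : ℝ) ≤ 4) hint
  set a : Fin d → ℝ := fun i => quadForm (covMat X μ) (EuclideanSpace.single i 1) with ha
  have hXi : ∀ ω i, inner ℝ (X ω) (EuclideanSpace.single i (1 : ℝ)) = X ω i := fun ω i => by
    simp [EuclideanSpace.inner_single_right]
  have ha0 : ∀ i, 0 ≤ a i := fun i => quadForm_covMat_nonneg hX hint2 h0 _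
  have htr : (covMat X μ).trace = ∑ i, a i := by
    refine Finset.sum_congr rfl fun i _ => ?_
    rw [ha, Matrix.diag_apply, covMat_apply hX hint2 h0]
    simp only
    rw [quadForm_covMat hX hint2 h0]
    simp_rw [hXi, sq]
  have hi4 : ∀ i, Integrable (fun ω => X ω i ^ 4) μ := fun i => by
    simpa only [hXi] using integrable_inner_pow_four hX hint (EuclideanSpace.single i (1 : ℝ))
  have hb4 : ∀ i, ∫ ω, X ω i ^ 4 ∂μ ≤ kappa X μ 4 ^ 4 * a i ^ 2 := fun i => by
    simpa only [hXi] using integral_inner_pow_four_le hX hint h0 (EuclideanSpace.single i (1 : ℝ))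
  -- Coordinates of zero variance vanish almost surely, so the convention `x / 0 = 0` is harmless in
  -- the weighted sum.
  have hae : ∀ᵐ ω ∂μ, ∀ i, a i = 0 → X ω i = 0 := by
    rw [ae_all_iff]
    intro i
    by_cases h : a i = 0
    · filter_upwards [inner_ae_eq_zero hX hint2 h0 h] with ω hω _
      rwa [hXi] at hω
    · exact Filter.Eventually.of_forall fun ω h' => absurd h' h
  have hκ := kappa_nonneg (X := X) (μ := μ) 4
  calc ∫ ω, ‖X ω‖ ^ 4 ∂μ ≤ ∫ ω, (∑ i, a i) * ∑ i, X ω i ^ 4 / a i ∂μ := by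
        refine integral_mono_of_nonneg (Filter.Eventually.of_forall fun ω => by positivity)
          ((integrable_finsetSum _ fun i _ => (hi4 i).div_const _).const_mul _) ?_
        filter_upwards [hae] with ω hω
        have h1 := Finset.sum_sq_le_sum_mul_sum_of_sq_le_mul Finset.univ
          (r := fun i => X ω i ^ 2) (f := a) (g := fun i => X ω i ^ 4 / a i)
          (fun i _ => ha0 i) (fun i _ => div_nonneg (by positivity) (ha0 i)) (fun i _ => by
            by_cases h : a i = 0
            · simp [h, hω i h]
            · field_simp; exact le_rfl)
        have h2 : ‖X ω‖ ^ 4 = (∑ i, X ω i ^ 2) ^ 2 := by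
          rw [show 4 = 2 * 2 by norm_num, pow_mul, EuclideanSpace.real_norm_sq_eq]
        rw [h2]
        exact h1
    _ = (∑ i, a i) * ∑ i, (∫ ω, X ω i ^ 4 ∂μ) / a i := by
        rw [integral_const_mul, integral_finsetSum _ fun i _ => (hi4 i).div_const _]
        simp_rw [integral_div]
    _ ≤ (∑ i, a i) * ∑ i, kappa X μ 4 ^ 4 * a i := by
        refine mul_le_mul_of_nonneg_left (Finset.sum_le_sum fun i _ => ?_)
          (Finset.sum_nonneg fun i _ => ha0 i)
        rcases (ha0 i).eq_or_lt with h | h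
        · simp [← h]
        · rw [div_le_iff₀ h]
          linarith [hb4 i]
    _ = _ := by rw [← Finset.mul_sum, htr]; ring

lemma exists_apply_self_pos (hX : AEMeasurable X μ)
    (hint : Integrable (fun ω => ‖X ω‖ ^ (2 : ℝ)) μ) (h0 : ∫ ω, X ω ∂μ = 0)
    (hcov : covMat X μ ≠ 0) : ∃ i, 0 < covMat X μ i i := by
  by_contra! h
  apply hcov
  ext i j
  have h1 : ∫ ω, X ω i ^ 2 ∂μ = 0 := by
    refine le_antisymm ?_ (integral_nonneg fun ω => sq_nonneg _)
    have := h i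
    rw [covMat_apply hX hint h0] at this
    simpa only [sq] using this
  rw [integral_eq_zero_iff_of_nonneg (fun ω => sq_nonneg _)
    (memLp_apply_two hX hint i).integrable_sq] at h1
  rw [covMat_apply hX hint h0, Matrix.zero_apply, ← integral_zero Ω ℝ (μ := μ)]
  refine integral_congr_ae ?_
  filter_upwards [h1] with ω hω
  have : X ω i = 0 := by simpa using hω
  rw [this, zero_mul]

lemma trace_covMat_pos (hX : AEMeasurable X μ)
    (hint : Integrable (fun ω => ‖X ω‖ ^ (2 : ℝ)) μ) (h0 : ∫ ω, X ω ∂μ = 0)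
    (hcov : covMat X μ ≠ 0) : 0 < (covMat X μ).trace := by
  obtain ⟨i, hi⟩ := exists_apply_self_pos hX hint h0 hcov
  refine Finset.sum_pos' (fun j _ => ?_) ⟨i, Finset.mem_univ i, hi⟩
  rw [Matrix.diag_apply, covMat_apply hX hint h0]
  exact integral_nonneg fun ω => mul_self_nonneg _

/-- If `κ₄` were zero, the bound on `E‖X‖⁴` would force `X = 0` almost surely. Positivity makes the
truncation level and the variance proxy positive. -/
lemma kappa_four_pos (hX : AEMeasurable X μ)
    (hint : Integrable (fun ω => ‖X ω‖ ^ (4 : ℝ)) μ) (h0 : ∫ ω, X ω ∂μ = 0)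
    (hcov : covMat X μ ≠ 0) : 0 < kappa X μ 4 := by
  have hint2 := integrable_norm_rpow_of_le hX (by norm_num) (by norm_num : (2 : ℝ) ≤ 4) hint
  refine (kappa_nonneg _).lt_of_ne fun h => ?_
  have h1 := integral_norm_pow_four_le hX hint h0
  rw [← h] at h1
  have hi : Integrable (fun ω => ‖X ω‖ ^ 4) μ := by
    refine hint.congr (Filter.Eventually.of_forall fun ω => ?_)
    simp only
    rw [show (4 : ℝ) = ((4 : ℕ) : ℝ) by norm_num, Real.rpow_natCast]
  have h2 : ∫ ω, ‖X ω‖ ^ 4 ∂μ = 0 :=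
    le_antisymm (by simpa using h1) (integral_nonneg fun ω => by positivity)
  rw [integral_eq_zero_iff_of_nonneg (fun ω => by positivity) hi] at h2
  obtain ⟨i, hpos⟩ := exists_apply_self_pos hX hint2 h0 hcov
  rw [covMat_apply hX hint2 h0] at hpos
  refine hpos.ne' ?_
  rw [← integral_zero Ω ℝ (μ := μ)]
  refine integral_congr_ae ?_
  filter_upwards [h2] with ω hω
  have : X ω = 0 := by simpa using hω
  simp [this]

end Moments

/-! ### From Gaussian averages back to the truncated process. -/

section Event

lemma integrable_smoothVar_sq {E : Type*} [NormedAddCommGroup E] [MeasurableSpace E]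
    {ν : Measure E} (h4 : Integrable (fun x => ‖x‖ ^ 4) ν) (b : ℝ) :
    Integrable (fun x => smoothVar b x ^ 2) ν := by
  have : (fun x : E => smoothVar b x ^ 2) = fun x => ‖x‖ ^ 4 * (1 / (2 * b) ^ 2) := by
    ext x
    rw [smoothVar, div_pow, ← pow_mul, mul_one_div]
  rw [this]
  exact h4.mul_const _

variable {E : Type*} [NormedAddCommGroup E] [InnerProductSpace ℝ E] [FiniteDimensional ℝ E]
  [MeasurableSpace E] [BorelSpace E]

lemma integrable_min_inner_sq (ν : Measure E) [IsProbabilityMeasure ν] {B : ℝ} (hB : 0 ≤ B)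
    (v : E) : Integrable (fun x => min (inner ℝ x v ^ 2) B) ν := by
  refine Integrable.of_bound (by fun_prop) B (Filter.Eventually.of_forall fun x => ?_)
  rw [Real.norm_eq_abs, abs_of_nonneg (le_min (sq_nonneg _) hB)]
  exact min_le_right _ _

lemma integrable_far_inner (ν : Measure E) [IsProbabilityMeasure ν] {B : ℝ} (hB : 0 ≤ B)
    (v : E) : Integrable (fun x => far B (inner ℝ x v)) ν := by
  have h : Measurable fun x : E => inner ℝ x v := by fun_prop
  refine Integrable.of_bound ((measurable_far B).comp h).aestronglyMeasurable (4 * B)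
    (Filter.Eventually.of_forall fun x => ?_)
  rw [Real.norm_eq_abs, abs_of_nonneg (far_nonneg hB _)]
  exact far_le hB _

lemma integrable_inner_pow_four_of_norm {ν : Measure E} (h4 : Integrable (fun x => ‖x‖ ^ 4) ν)
    (v : E) : Integrable (fun x => inner ℝ x v ^ 4) ν := by
  refine Integrable.mono' (h4.mul_const (‖v‖ ^ 4)) (by fun_prop)
    (Filter.Eventually.of_forall fun x => ?_)
  rw [Real.norm_eq_abs, abs_pow, ← mul_pow]
  exact pow_le_pow_left₀ (abs_nonneg _) (abs_real_inner_le_norm _ _) 4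

lemma integrable_integral_comp_add {ν : Measure E} [IsProbabilityMeasure ν] {b : ℝ} (hb : 0 < b)
    {F : E → E → ℝ} (hF : Measurable (Function.uncurry F)) {M : ℝ} (hM : ∀ x θ, |F x θ| ≤ M)
    (v : E) : Integrable (fun x => ∫ g, F x (v + g) ∂(gaussPrior E b)) ν := by
  have := isProbabilityMeasure_gaussPrior (E := E) hb
  have h : Measurable fun p : E × E => (p.1, v + p.2) := by fun_prop
  have h2 : Integrable (fun p : E × E => F p.1 (v + p.2)) (ν.prod (gaussPrior E b)) :=
    Integrable.of_bound (hF.comp h).aestronglyMeasurable M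
      (Filter.Eventually.of_forall fun g => hM _ _)
  exact h2.integral_prod_left

/-- A uniform deviation inequality for truncated squares of linear forms. -/
theorem exists_truncation_event (ν : Measure E) [IsProbabilityMeasure ν]
    (h4 : Integrable (fun x => ‖x‖ ^ 4) ν) {b B : ℝ} (hb : 0 < b) (hB : 0 < B) (n : ℕ)
    {δ V R lam : ℝ} (hδ : 0 < δ)
    (hV : ∀ v : E, ‖v‖ = 1 → ∫ x, 10 ^ 6 * (inner ℝ x v ^ 4 + smoothVar b x ^ 2) ∂ν ≤ V)
    (hR : ∀ v : E, ‖v‖ = 1 →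
      ∫ x, (far B (inner ℝ x v) + 122880 / B * smoothVar b x ^ 2) ∂ν ≤ R)
    (hlam : 0 < lam) (hlB : lam * (7 * B) ≤ 1) :
    ∃ G : Set (Fin n → E), MeasurableSet G ∧
      Measure.pi (fun _ : Fin n => ν) Gᶜ ≤ ENNReal.ofReal (2 * δ) ∧
      ∀ xs ∈ G, ∀ v : E, ‖v‖ = 1 →
        |∑ i, (min (inner ℝ (xs i) v ^ 2) B - ∫ x, min (inner ℝ x v ^ 2) B ∂ν)| ≤
          n * R + lam * n * V + (b + Real.log (1 / δ)) / lam := by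
  have hS := integrable_smoothVar_sq h4 b
  -- The majorant controls upper deviations and the negated minorant lower ones, each at cost `δ`.
  obtain ⟨G₁, hG₁, hP₁, hb₁⟩ := exists_pacBayes_event ν hb (measurable_truncUpper (E := E) b B)
    (abs_truncUpper_le hb hB) hlam hlB n hδ
  obtain ⟨G₂, hG₂, hP₂, hb₂⟩ := exists_pacBayes_event ν hb
    (H := fun x θ : E => -truncLower b B x θ) (measurable_truncLower (E := E) b B).neg
    (fun x θ => by rw [abs_neg]; exact abs_truncLower_le hb hB x θ) hlam hlB n hδ
  refine ⟨G₁ ∩ G₂, hG₁.inter hG₂, ?_, ?_⟩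
  · rw [Set.compl_inter, two_mul, ENNReal.ofReal_add hδ.le hδ.le]
    exact (measure_union_le _ _).trans (add_le_add hP₁ hP₂)
  · intro xs hxs v hv
    have hi := integrable_min_inner_sq ν hB.le v
    have hfar := integrable_far_inner ν hB.le v
    have hV' : ∀ {F : E → E → ℝ},
        (∀ x θ, F x θ ^ 2 ≤ 243 * inner ℝ x θ ^ 4 + 147459 * smoothVar b x ^ 2) →
        ∫ x, ∫ g, F x (v + g) ^ 2 ∂(gaussPrior E b) ∂ν ≤ V := by
      intro F hF
      refine le_trans (integral_mono_of_nonneg (Filter.Eventually.of_forall fun x =>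
        integral_nonneg fun g => sq_nonneg _) ?_
        (Filter.Eventually.of_forall fun x => integral_sq_le_of_sq_le hb hF x v)) (hV v hv)
      exact ((integrable_inner_pow_four_of_norm h4 v).add hS).const_mul _
    have hn : (0 : ℝ) ≤ n := Nat.cast_nonneg n
    have hln : 0 ≤ lam * n := by positivity
    have h1 := hb₁ xs hxs.1 v
    have h2 := hb₂ xs hxs.2 v
    rw [hv, one_pow, mul_one] at h1 h2
    have hV₁ := mul_le_mul_of_nonneg_left (hV' (truncUpper_sq_le hb hB)) hln
    have hV₂ := mul_le_mul_of_nonneg_left (hV' (F := fun x θ => -truncLower b B x θ)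
      (fun x θ => by simpa only [neg_sq] using truncLower_sq_le hb hB x θ)) hln
    simp only [integral_neg, Finset.sum_neg_distrib] at h2
    have hu : ∑ i, min (inner ℝ (xs i) v ^ 2) B ≤
        ∑ i, ∫ g, truncUpper b B (xs i) (v + g) ∂(gaussPrior E b) :=
      Finset.sum_le_sum fun i _ => min_le_integral_truncUpper hb hB _ _
    have hl : ∑ i, ∫ g, truncLower b B (xs i) (v + g) ∂(gaussPrior E b) ≤
        ∑ i, min (inner ℝ (xs i) v ^ 2) B :=
      Finset.sum_le_sum fun i _ => integral_truncLower_le hb hB _ _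
    have hir : Integrable (fun x => far B (inner ℝ x v) + 122880 / B * smoothVar b x ^ 2) ν :=
      hfar.add (hS.const_mul _)
    have hup : ∫ x, ∫ g, truncUpper b B x (v + g) ∂(gaussPrior E b) ∂ν ≤
        ∫ x, min (inner ℝ x v ^ 2) B ∂ν + R := by
      refine le_trans (integral_mono
        (integrable_integral_comp_add hb (measurable_truncUpper b B) (abs_truncUpper_le hb hB) v)
        (hi.add hir) fun x => integral_truncUpper_le hb hB x v) ?_
      rw [integral_add' hi hir]
      linarith [hR v hv]
    have hlo : ∫ x, min (inner ℝ x v ^ 2) B ∂ν ≤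
        ∫ x, ∫ g, truncLower b B x (v + g) ∂(gaussPrior E b) ∂ν + R := by
      have hil := integrable_integral_comp_add (ν := ν) hb (measurable_truncLower b B)
        (abs_truncLower_le hb hB) v
      refine le_trans (integral_mono hi (hil.add hir) fun x => ?_) ?_
      · have h5 := min_le_integral_truncLower_add hb hB x v
        have h6 : 24576 / B * smoothVar b x ^ 2 ≤ 122880 / B * smoothVar b x ^ 2 := by
          gcongr; norm_num
        simp only [Pi.add_apply]
        linarith
      · rw [integral_add' hil hir]
        linarith [hR v hv]
    have hup' := mul_le_mul_of_nonneg_left hup hn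
    have hlo' := mul_le_mul_of_nonneg_left hlo hn
    rw [Finset.sum_sub_distrib, Finset.sum_const, Finset.card_univ, Fintype.card_fin,
      nsmul_eq_mul, abs_le]
    constructor <;> linarith

end Event

/-! ### Tail probability at the truncation level and Bernstein's parameter. -/

section Assembly

lemma far_le_rpow {B p : ℝ} (hB : 0 < B) (hp : 0 ≤ p) (y : ℝ) :
    far B y ≤ 4 * B * ((4 / B) ^ (p / 2) * |y| ^ p) := by
  unfold far
  split_ifs with h
  · have h1 : (4 / B) ^ (p / 2) * |y| ^ p = (4 / B * y ^ 2) ^ (p / 2) := by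
      rw [Real.mul_rpow (by positivity) (sq_nonneg y)]
      congr 1
      rw [← sq_abs, ← Real.rpow_natCast, ← Real.rpow_mul (abs_nonneg y)]
      congr 1
      push_cast
      ring
    rw [h1]
    have h2 : 1 ≤ (4 / B * y ^ 2) ^ (p / 2) := by
      refine Real.one_le_rpow ?_ (by positivity)
      rw [div_mul_eq_mul_div, le_div_iff₀ hB]
      linarith
    nlinarith
  · positivity

/-- Markov's bound for `⟨X, v⟩² > B/4`: the `4 / B` comes from this threshold and cancels the factor
4 in the first entry of the level. -/
lemma rpow_tail_le {B K T p s : ℝ} (hB : 0 < B) (hK : 0 ≤ K) (hT : 0 ≤ T) (hp : 0 < p)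
    (hs : 0 < s) (h : T * (4 * K ^ 2 * s ^ (2 / p)) ≤ B) :
    (4 / B) ^ (p / 2) * (K ^ p * T ^ (p / 2)) ≤ 1 / s := by
  have h1 : K ^ p = (K ^ 2) ^ (p / 2) := by
    rw [← Real.rpow_natCast, ← Real.rpow_mul hK]
    congr 1
    push_cast
    ring
  rw [h1, ← Real.mul_rpow (by positivity) hT, ← Real.mul_rpow (by positivity) (by positivity)]
  have h2 : 4 / B * (K ^ 2 * T) ≤ (1 / s) ^ (2 / p) := by
    rw [Real.div_rpow zero_le_one hs.le, Real.one_rpow, le_div_iff₀ (by positivity),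
      div_mul_eq_mul_div, div_mul_eq_mul_div, div_le_one hB]
    linarith
  calc (4 / B * (K ^ 2 * T)) ^ (p / 2) ≤ ((1 / s) ^ (2 / p)) ^ (p / 2) :=
        Real.rpow_le_rpow (by positivity) h2 (by positivity)
    _ = 1 / s := by
        rw [← Real.rpow_mul (by positivity), div_mul_div_cancel₀ hp.ne', div_self two_ne_zero,
          Real.rpow_one]

/-- The choice of the free parameter in Bernstein's inequality. -/
lemma exists_bernstein_parameter {B V t n : ℝ} (hB : 0 < B) (hV : 0 < V) (ht : 0 < t)
    (hn : 0 < n) : ∃ lam : ℝ, 0 < lam ∧ lam * (7 * B) ≤ 1 ∧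
      lam * n * V + 3 * t / lam ≤ 21 * (B * t) + 4 * √(t * n * V) := by
  set s := √(t / (n * V)) with hs
  have hs0 : 0 < s := Real.sqrt_pos.2 (by positivity)
  have hs2 : s ^ 2 = t / (n * V) := Real.sq_sqrt (by positivity)
  have h1 : s * n * V = √(t * n * V) := by
    rw [eq_comm, Real.sqrt_eq_iff_mul_self_eq (by positivity) (by positivity), eq_comm]
    calc s * n * V * (s * n * V) = s ^ 2 * (n * V) ^ 2 := by ring
      _ = t * n * V := by rw [hs2]; field_simp
  have h2 : t / s = √(t * n * V) := by
    rw [← h1, div_eq_iff hs0.ne']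
    calc t = s ^ 2 * (n * V) := by rw [hs2]; field_simp
      _ = _ := by ring
  -- The minimiser of the two terms up to a constant, capped so that Bernstein applies; the cap
  -- produces the term `B * t`.
  refine ⟨min (1 / (7 * B)) s, lt_min (by positivity) hs0, ?_, ?_⟩
  · calc min (1 / (7 * B)) s * (7 * B) ≤ 1 / (7 * B) * (7 * B) := by
          gcongr; exact min_le_left _ _
      _ = 1 := by field_simp
  · have h3 : min (1 / (7 * B)) s * n * V ≤ s * n * V := by
      gcongr; exact min_le_right _ _
    have h4 : 3 * t / min (1 / (7 * B)) s ≤ 21 * (B * t) + 3 * (t / s) := by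
      have h5 : 0 ≤ t / s := by positivity
      rcases min_cases (1 / (7 * B)) s with h | h
      · rw [h.1]
        have : 3 * t / (1 / (7 * B)) = 21 * (B * t) := by field_simp; ring
        linarith
      · rw [h.1, mul_div_assoc]
        have : 0 ≤ B * t := by positivity
        linarith
    linarith

end Assembly

/-! ### Numerical estimates for the three error terms. -/

section Final

lemma sqrt_div_rpow_mul {n t : ℝ} (hn : 0 < n) (ht : 0 < t) :
    √n / t ^ (3 / 2 : ℝ) * (t / n) = 1 / √(n * t) := by
  have h1 : t ^ (3 / 2 : ℝ) = t * √t := by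
    rw [Real.sqrt_eq_rpow, show (3 / 2 : ℝ) = 1 + 1 / 2 by norm_num, Real.rpow_add ht,
      Real.rpow_one]
  rw [h1, Real.sqrt_mul hn.le]
  have h2 : 0 < √n := Real.sqrt_pos.2 hn
  have h3 : 0 < √t := Real.sqrt_pos.2 ht
  field_simp
  rw [Real.sq_sqrt hn.le]

lemma rpow_two_div_mul_le {n t p : ℝ} (hn : 0 < n) (ht : 0 < t) (hp : 2 ≤ p) :
    (2000 * n / t) ^ (2 / p) * (t / n) ≤ 2000 * (t / n) ^ (1 - 2 / p) := by
  have h1 : 2000 * n / t = 2000 * (t / n)⁻¹ := by rw [inv_div]; ring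
  have h2 : (0 : ℝ) < t / n := by positivity
  rw [h1, Real.mul_rpow (by norm_num) (by positivity), Real.inv_rpow h2.le, Real.rpow_sub h2,
    Real.rpow_one]
  have h3 : (2000 : ℝ) ^ (2 / p) ≤ 2000 := by
    calc (2000 : ℝ) ^ (2 / p) ≤ 2000 ^ (1 : ℝ) :=
          Real.rpow_le_rpow_of_exponent_le (by norm_num)
            ((div_le_one (by linarith)).2 hp)
      _ = 2000 := Real.rpow_one _
  calc (2000 : ℝ) ^ (2 / p) * ((t / n) ^ (2 / p))⁻¹ * (t / n)
      = (2000 : ℝ) ^ (2 / p) * (t / n / (t / n) ^ (2 / p)) := by ring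
    _ ≤ _ := by gcongr

lemma level_mul_le {n t p T K k r : ℝ} (hn : 0 < n) (ht : 0 < t) (hp : 2 ≤ p) (hT : 0 ≤ T)
    (hr : 0 ≤ r) :
    T * max (4 * K ^ 2 * (2000 * n / t) ^ (2 / p)) (512 * k ^ 2 * r * (√n / t ^ (3 / 2 : ℝ)))
        * (t / n) ≤
      8000 * K ^ 2 * T * (t / n) ^ (1 - 2 / p) + 512 * k ^ 2 * T * (r / √(n * t)) := by
  have h1 : max (4 * K ^ 2 * (2000 * n / t) ^ (2 / p))
      (512 * k ^ 2 * r * (√n / t ^ (3 / 2 : ℝ))) ≤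
      4 * K ^ 2 * (2000 * n / t) ^ (2 / p) + 512 * k ^ 2 * r * (√n / t ^ (3 / 2 : ℝ)) :=
    max_le_add_of_nonneg (by positivity) (by positivity)
  calc _ ≤ T * (4 * K ^ 2 * (2000 * n / t) ^ (2 / p)
          + 512 * k ^ 2 * r * (√n / t ^ (3 / 2 : ℝ))) * (t / n) := by gcongr
    _ = 4 * K ^ 2 * T * ((2000 * n / t) ^ (2 / p) * (t / n))
          + 512 * k ^ 2 * T * (r * (√n / t ^ (3 / 2 : ℝ) * (t / n))) := by ring
    _ ≤ 4 * K ^ 2 * T * (2000 * (t / n) ^ (1 - 2 / p))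
          + 512 * k ^ 2 * T * (r * (1 / √(n * t))) := by
        rw [sqrt_div_rpow_mul hn ht]
        exact add_le_add_left (mul_le_mul_of_nonneg_left (rpow_two_div_mul_le hn ht hp)
          (by positivity)) _
    _ = _ := by ring

/-- One factor `k² r` cancels against the lower bound on `B`, with `122880 / 512 = 240`. Here `r`
plays the role of the trace. -/
lemma smoothing_error_le {n t k r B : ℝ} (hn : 0 < n) (ht : 0 < t) (hB : 0 < B) (hr : 0 ≤ r)
    (h : 512 * k ^ 2 * r * (√n / t ^ (3 / 2 : ℝ)) ≤ B) :
    122880 / B * (k ^ 4 * r ^ 2 / t ^ 2) ≤ 240 * k ^ 2 * (r / √(n * t)) := by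
  have h1 := sqrt_div_rpow_mul hn ht
  have hs : 0 < √(n * t) := Real.sqrt_pos.2 (by positivity)
  have hss : √(n * t) ^ 2 = n * t := Real.sq_sqrt (by positivity)
  have h2 : 512 * k ^ 2 * r * (1 / √(n * t)) ≤ B * (t / n) := by
    rw [← h1, ← mul_assoc]
    gcongr
  have h3 : 512 * k ^ 2 * r * √(n * t) ≤ B * t ^ 2 := by
    have h4 := mul_le_mul_of_nonneg_right h2 (by positivity : 0 ≤ n * t)
    calc 512 * k ^ 2 * r * √(n * t) = 512 * k ^ 2 * r * (1 / √(n * t)) * √(n * t) ^ 2 := by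
          field_simp
      _ = 512 * k ^ 2 * r * (1 / √(n * t)) * (n * t) := by rw [hss]
      _ ≤ B * (t / n) * (n * t) := h4
      _ = B * t ^ 2 := by field_simp
  rw [div_mul_div_comm, mul_div_assoc', div_le_div_iff₀ (by positivity) hs]
  have h5 : 0 ≤ 240 * k ^ 2 * r := by positivity
  have h6 := mul_le_mul_of_nonneg_left h3 h5
  linarith

/-- This is `√(x² + y²) ≤ x + y`, with `r` the trace. -/
lemma sqrt_variance_le {n t k T r : ℝ} (hn : 0 < n) (ht : 0 < t) (hT : 0 ≤ T) (hr : 0 ≤ r) :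
    √(t * n * (10 ^ 6 * (k ^ 4 * T ^ 2 + k ^ 4 * r ^ 2 / t ^ 2))) / n ≤
      1000 * k ^ 2 * T * √(t / n) + 1000 * k ^ 2 * (r / √(n * t)) := by
  have h1 : 1 / √(n * t) = √(t / n) / t := by
    rw [Real.sqrt_mul hn.le, Real.sqrt_div ht.le]
    have h2 : 0 < √n := Real.sqrt_pos.2 hn
    have h3 : 0 < √t := Real.sqrt_pos.2 ht
    field_simp
    rw [Real.sq_sqrt ht.le]
  have hs : √(t / n) ^ 2 = t / n := Real.sq_sqrt (by positivity)
  rw [div_le_iff₀ hn]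
  apply Real.sqrt_le_iff.2
  refine ⟨by positivity, ?_⟩
  have h2 : (1000 * k ^ 2 * T * √(t / n) + 1000 * k ^ 2 * (r / √(n * t))) * n =
      √(t / n) * n * (1000 * k ^ 2 * (T + r / t)) := by
    rw [div_eq_mul_one_div r, h1]; ring
  have h3 : (√(t / n) * n * (1000 * k ^ 2 * (T + r / t))) ^ 2 =
      t * n * (10 ^ 6 * (k ^ 4 * (T + r / t) ^ 2)) := by
    calc _ = √(t / n) ^ 2 * n ^ 2 * (10 ^ 6 * (k ^ 4 * (T + r / t) ^ 2)) := by ring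
      _ = _ := by rw [hs]; field_simp
  rw [h2, h3]
  have h4 : k ^ 4 * T ^ 2 + k ^ 4 * r ^ 2 / t ^ 2 ≤ k ^ 4 * (T + r / t) ^ 2 := by
    have h5 : k ^ 4 * (T + r / t) ^ 2 =
        k ^ 4 * T ^ 2 + k ^ 4 * r ^ 2 / t ^ 2 + 2 * (k ^ 4 * (T * (r / t))) := by ring
    rw [h5]
    have : 0 ≤ k ^ 4 * (T * (r / t)) := by positivity
    linarith
  gcongr

lemma ofReal_one_sub_le_measure_preimage {Ω 𝒴 : Type*} [MeasurableSpace Ω] [MeasurableSpace 𝒴]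
    {μ : Measure Ω} [IsProbabilityMeasure μ] {Y : Ω → 𝒴} (hY : AEMeasurable Y μ) {G : Set 𝒴}
    (hG : MeasurableSet G) {α : ℝ} (hα : 0 ≤ α) (h : μ.map Y Gᶜ ≤ ENNReal.ofReal α) :
    ENNReal.ofReal (1 - α) ≤ μ (Y ⁻¹' G) := by
  rw [Measure.map_apply_of_aemeasurable hY hG.compl] at h
  rw [ENNReal.ofReal_sub _ hα, ENNReal.ofReal_one, tsub_le_iff_right, ← measure_univ (μ := μ),
    ← Set.union_compl_self (Y ⁻¹' G)]
  exact (measure_union_le _ _).trans (by gcongr; exact h)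

end Final

end TruncatedCovariance

/-! ### Choice of parameters and conclusion. -/

open TruncatedCovariance in
theorem mainTheorem4 :
    ∃ C : ℝ, 0 < C ∧
      ∀ (Ω : Type*) [MeasurableSpace Ω] (μ : Measure Ω) [IsProbabilityMeasure μ]
        (d n : ℕ) (_ : 0 < n) (p : ℝ) (_ : 4 ≤ p)
        (X₀ : Ω → EuclideanSpace ℝ (Fin d)) (X : Fin n → Ω → EuclideanSpace ℝ (Fin d))
        (_ : iIndepFun X μ) (_ : ∀ i, IdentDistrib (X i) X₀ μ μ)
        (_ : Integrable (fun ω => ‖X₀ ω‖ ^ p) μ) (_ : ∫ ω, X₀ ω ∂μ = 0)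
        (_ : covMat X₀ μ ≠ 0)
        (α : ℝ) (_ : 0 < α) (_ : α < 1) (t : ℕ) (_ : 2 ≤ t)
        (_ : Real.log (8 / (3 * α)) ≤ (t : ℝ)),
        ENNReal.ofReal (1 - α) ≤
          μ {ω | truncProcess X μ (truncLevel X₀ μ n p (t : ℝ)) ω ≤
            C * kappa X₀ μ 4 ^ 2 * opNorm (covMat X₀ μ) *
                √(((t : ℝ) + 2 * Real.log (8 / α)) / (n : ℝ))
              + C * kappa X₀ μ p ^ 2 * opNorm (covMat X₀ μ) *
                ((t : ℝ) / (n : ℝ)) ^ (1 - 2 / p)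
              + C * kappa X₀ μ 4 ^ 2 * opNorm (covMat X₀ μ) *
                (stableRank (covMat X₀ μ) / √((n : ℝ) * (t : ℝ)))} := by
  -- `176000 = 22 · 8000` comes from the `κ_p` term: `B * (t / n)` occurs at most 22 times, 21 from
  -- Bernstein and at most one from the bias. The other terms need only `4000` and `22 · 512 + 240 +
  -- 4000`.
  refine ⟨176000, by norm_num, ?_⟩
  intro Ω _ μ _ d n hn p hp X₀ X hind hid hint h0 hcov α hα0 hα1 t ht hlog
  have hX : AEMeasurable X₀ μ := (hid ⟨0, hn⟩).aemeasurable_snd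
  have hint4 := integrable_norm_rpow_of_le hX (by norm_num) hp hint
  have hint2 := integrable_norm_rpow_of_le hX (by norm_num) (by norm_num : (2 : ℝ) ≤ 4) hint4
  have hk := kappa_four_pos hX hint4 h0 hcov
  have hkp := kappa_nonneg (X := X₀) (μ := μ) p
  have hT := opNorm_pos hcov
  have htr := trace_covMat_pos hX hint2 h0 hcov
  have hn' : (0 : ℝ) < n := by exact_mod_cast hn
  have ht2 : (2 : ℝ) ≤ t := by exact_mod_cast ht
  have ht' : (0 : ℝ) < t := by linarith
  have hsr : 0 < stableRank (covMat X₀ μ) := div_pos htr hT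
  have hTsr : opNorm (covMat X₀ μ) * stableRank (covMat X₀ μ) = (covMat X₀ μ).trace :=
    mul_div_cancel₀ _ hT.ne'
  have hlevel := level_mul_le (n := n) (t := t) (p := p) (T := opNorm (covMat X₀ μ))
    (K := kappa X₀ μ p) (k := kappa X₀ μ 4) (r := stableRank (covMat X₀ μ)) hn' ht' (by linarith)
    hT.le hsr.le
  rw [← truncLevel] at hlevel
  have hB1 : opNorm (covMat X₀ μ) * (4 * kappa X₀ μ p ^ 2 * (2000 * (n : ℝ) / t) ^ (2 / p)) ≤
      truncLevel X₀ μ n p t := by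
    rw [truncLevel]; gcongr; exact le_max_left _ _
  have hB2 : 512 * kappa X₀ μ 4 ^ 2 * (covMat X₀ μ).trace * (√(n : ℝ) / t ^ (3 / 2 : ℝ)) ≤
      truncLevel X₀ μ n p t := by
    calc _ = opNorm (covMat X₀ μ) * (512 * kappa X₀ μ 4 ^ 2 * stableRank (covMat X₀ μ) *
          (√(n : ℝ) / t ^ (3 / 2 : ℝ))) := by rw [← hTsr]; ring
      _ ≤ _ := by rw [truncLevel]; gcongr; exact le_max_right _ _
  have hB : 0 < truncLevel X₀ μ n p t := lt_of_lt_of_le (by positivity) hB2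
  set B := truncLevel X₀ μ n p t with hBdef
  set T := opNorm (covMat X₀ μ) with hTdef
  set k := kappa X₀ μ 4
  set K := kappa X₀ μ p
  set r := (covMat X₀ μ).trace
  set ν := μ.map X₀ with hν
  have : IsProbabilityMeasure ν := Measure.isProbabilityMeasure_map hX
  have hi4 : Integrable (fun ω => ‖X₀ ω‖ ^ 4) μ := by
    refine hint4.congr (Filter.Eventually.of_forall fun ω => ?_)
    simp only
    rw [show (4 : ℝ) = ((4 : ℕ) : ℝ) by norm_num, Real.rpow_natCast]
  have h4 : Integrable (fun x => ‖x‖ ^ 4) ν :=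
    (integrable_map_measure (by fun_prop) hX).2 hi4
  -- The choice `b = t/2` gives smoothing variance `‖x‖²/t` at entropy cost `t/2` on the unit
  -- sphere.
  have hS : ∀ x : EuclideanSpace ℝ (Fin d), smoothVar ((t : ℝ) / 2) x ^ 2 = ‖x‖ ^ 4 / t ^ 2 := by
    intro x
    rw [smoothVar, mul_div_cancel₀ _ two_ne_zero, div_pow, ← pow_mul]
  have hS4 : ∫ x, smoothVar ((t : ℝ) / 2) x ^ 2 ∂ν ≤ k ^ 4 * r ^ 2 / t ^ 2 := by
    simp_rw [hS]
    rw [integral_div, hν, integral_map hX (by fun_prop)]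
    gcongr
    exact integral_norm_pow_four_le hX hint4 h0
  have hiS := integrable_smoothVar_sq h4 ((t : ℝ) / 2)
  have hq : ∀ v : EuclideanSpace ℝ (Fin d), ‖v‖ = 1 → quadForm (covMat X₀ μ) v ≤ T := by
    intro v hv
    simpa [hv] using quadForm_le (M := covMat X₀ μ) v
  set V := 10 ^ 6 * (k ^ 4 * T ^ 2 + k ^ 4 * r ^ 2 / t ^ 2) with hVdef
  set R := 4 * B * (1 / (2000 * n / t)) + 122880 / B * (k ^ 4 * r ^ 2 / t ^ 2) with hRdef
  have hV : ∀ v : EuclideanSpace ℝ (Fin d), ‖v‖ = 1 →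
      ∫ x, 10 ^ 6 * (inner ℝ x v ^ 4 + smoothVar ((t : ℝ) / 2) x ^ 2) ∂ν ≤ V := by
    intro v hv
    rw [integral_const_mul, integral_add (integrable_inner_pow_four_of_norm h4 v) hiS]
    have h5 : ∫ x, inner ℝ x v ^ 4 ∂ν ≤ k ^ 4 * T ^ 2 := by
      rw [hν, integral_map hX (by fun_prop)]
      refine (integral_inner_pow_four_le hX hint4 h0 v).trans ?_
      have := quadForm_covMat_nonneg hX hint2 h0 v
      gcongr
      exact hq v hv
    rw [hVdef]
    gcongr
  have hR : ∀ v : EuclideanSpace ℝ (Fin d), ‖v‖ = 1 →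
      ∫ x, (far B (inner ℝ x v) + 122880 / B * smoothVar ((t : ℝ) / 2) x ^ 2) ∂ν ≤ R := by
    intro v hv
    have hm : Measurable fun x : EuclideanSpace ℝ (Fin d) => inner ℝ x v := by fun_prop
    rw [integral_add (integrable_far_inner ν hB.le v) (hiS.const_mul _), integral_const_mul]
    have h5 : ∫ x, far B (inner ℝ x v) ∂ν ≤ 4 * B * (1 / (2000 * n / t)) := by
      have hfm : Measurable fun x : EuclideanSpace ℝ (Fin d) => far B (inner ℝ x v) :=
        (measurable_far B).comp hm
      rw [hν, integral_map hX hfm.aestronglyMeasurable]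
      calc ∫ ω, far B (inner ℝ (X₀ ω) v) ∂μ
          ≤ ∫ ω, 4 * B * ((4 / B) ^ (p / 2) * |inner ℝ (X₀ ω) v| ^ p) ∂μ :=
            integral_mono_of_nonneg (Filter.Eventually.of_forall fun ω => far_nonneg hB.le _)
              (((integrable_abs_inner_rpow hX (by linarith) hint v).const_mul _).const_mul _)
              (Filter.Eventually.of_forall fun ω => far_le_rpow hB (by linarith) _)
        _ = 4 * B * ((4 / B) ^ (p / 2) * ∫ ω, |inner ℝ (X₀ ω) v| ^ p ∂μ) := by
            rw [integral_const_mul, integral_const_mul]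
        _ ≤ 4 * B * ((4 / B) ^ (p / 2) * (K ^ p * T ^ (p / 2))) := by
            gcongr
            refine (integral_abs_inner_rpow_le hX (by linarith) hint h0 v).trans ?_
            have := quadForm_covMat_nonneg hX hint2 h0 v
            have := hq v hv
            gcongr
        _ ≤ 4 * B * (1 / (2000 * n / t)) := by
            gcongr
            exact rpow_tail_le hB hkp hT.le (by linarith) (by positivity) hB1
    rw [hRdef]
    gcongr
  obtain ⟨lam, hlam, hlamB, hlamV⟩ := exists_bernstein_parameter hB
    (by positivity : 0 < V) ht' hn'
  obtain ⟨G, hG, hGP, hGb⟩ := exists_truncation_event ν h4 (by positivity : 0 < (t : ℝ) / 2) hB n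
    (by positivity : 0 < α / 2) hV hR hlam hlamB
  have hXm : ∀ i, AEMeasurable (X i) μ := fun i => (hid i).aemeasurable_fst
  have hmap : μ.map (fun ω i => X i ω) = Measure.pi fun _ : Fin n => ν := by
    rw [(iIndepFun_iff_map_fun_eq_pi_map hXm).1 hind]
    congr 1
    ext1 i
    exact (hid i).map_eq
  rw [mul_div_cancel₀ _ two_ne_zero, ← hmap] at hGP
  -- Monotonicity of the measure avoids any measurability question for the supremum over directions.
  refine (ofReal_one_sub_le_measure_preimage (aemeasurable_pi_lambda _ hXm) hG hα0.le hGP).trans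
    (measure_mono fun ω hω => ?_)
  have hlog8 : 0 ≤ Real.log (8 / α) :=
    Real.log_nonneg ((one_le_div hα0).2 (by linarith))
  -- `log(2/α) ≤ log 3 + log(8/(3α)) ≤ 2 + t ≤ 2t`; the last inequality uses `t ≥ 2`.
  have hlog2 : (t : ℝ) / 2 + Real.log (1 / (α / 2)) ≤ 3 * t := by
    have h5 : Real.log (1 / (α / 2)) ≤ Real.log (3 * (8 / (3 * α))) := by
      apply Real.log_le_log (by positivity)
      rw [show 1 / (α / 2) = 2 / α by field_simp, show 3 * (8 / (3 * α)) = 8 / α by field_simp]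
      gcongr
      norm_num
    rw [Real.log_mul (by norm_num) (by positivity)] at h5
    have h6 := Real.log_le_sub_one_of_pos (by norm_num : (0 : ℝ) < 3)
    linarith
  have hsqrt : √((t : ℝ) / n) ≤ √(((t : ℝ) + 2 * Real.log (8 / α)) / n) := by
    apply Real.sqrt_le_sqrt
    gcongr
    linarith
  have hsm := smoothing_error_le hn' ht' hB htr.le hB2
  have hvar := sqrt_variance_le (k := k) hn' ht' hT.le htr.le
  rw [← hVdef] at hvar
  have hrT : T * (stableRank (covMat X₀ μ) / √((n : ℝ) * t)) = r / √((n : ℝ) * t) := by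
    rw [← mul_div_assoc, hTsr]
  have hmain : ∀ v : EuclideanSpace ℝ (Fin d), ‖v‖ = 1 → (1 / (n : ℝ)) *
      |∑ i, (min (inner ℝ (X i ω) v ^ 2) B - ∫ ω', min (inner ℝ (X i ω') v ^ 2) B ∂μ)| ≤
      R + 21 * (B * (t / n)) + 4 * (√(t * n * V) / n) := by
    intro v hv
    have h5 : ∀ i, ∫ ω', min (inner ℝ (X i ω') v ^ 2) B ∂μ =
        ∫ x, min (inner ℝ x v ^ 2) B ∂ν := by
      intro i
      rw [hν, ← (hid i).map_eq, integral_map (hXm i) (by fun_prop)]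
    simp_rw [h5]
    have h6 : ((t : ℝ) / 2 + Real.log (1 / (α / 2))) / lam ≤ 3 * t / lam := by gcongr
    have h7 := (hGb _ hω v hv).trans
      (by linarith : _ ≤ n * R + (21 * (B * t) + 4 * √(t * n * V)))
    calc _ ≤ 1 / (n : ℝ) * (n * R + (21 * (B * t) + 4 * √(t * n * V))) := by gcongr
      _ = _ := by field_simp; ring
  have hR' : R ≤ B * (t / n) + 240 * k ^ 2 * (r / √((n : ℝ) * t)) := by
    have h5 : 4 * B * (1 / (2000 * n / t)) ≤ B * ((t : ℝ) / n) := by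
      have h6 : 4 * B * (1 / (2000 * n / t)) = 4 / 2000 * (B * ((t : ℝ) / n)) := by field_simp
      have h7 : 0 ≤ B * ((t : ℝ) / n) := by positivity
      rw [h6]
      linarith
    rw [hRdef]
    linarith
  set a₁ := √(((t : ℝ) + 2 * Real.log (8 / α)) / n)
  set a₂ := ((t : ℝ) / n) ^ (1 - 2 / p)
  have ha₁ : 1000 * k ^ 2 * T * √((t : ℝ) / n) ≤ 1000 * (k ^ 2 * T * a₁) := by
    rw [show 1000 * k ^ 2 * T * √((t : ℝ) / n) = 1000 * (k ^ 2 * T * √((t : ℝ) / n)) by ring]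
    gcongr
  have hp₁ : 0 ≤ k ^ 2 * T * a₁ := by positivity
  have hp₂ : 0 ≤ K ^ 2 * T * a₂ := by positivity
  have hp₃ : 0 ≤ k ^ 2 * (r / √((n : ℝ) * t)) := by positivity
  have e₃ : ∀ c : ℝ, c * k ^ 2 * T * (stableRank (covMat X₀ μ) / √((n : ℝ) * t)) =
      c * (k ^ 2 * (r / √((n : ℝ) * t))) := fun c => by rw [← hrT]; ring
  rw [Set.mem_ofPred_eq, e₃]
  rw [e₃] at hlevel
  -- Nonnegativity of the bound covers the default value 0 of a real supremum.
  refine Real.iSup_le (fun v => ?_) (by positivity)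
  refine (hmain v.1 (by simp)).trans ?_
  linarith
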